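/- **Setting.** Rate vectors are $R=(R_1,R_2,R_3,R_{12},R_{13},R_{23},R_{123})\in\mathbb R^7$, indexed by the nonempty $I\subseteq\{1,2,3\}$. A (discrete memoryless, finite-alphabet) 3-user multiple access channel is a transition function $p(y\mid x_1,x_2,x_3)$. Message $W_I$ is known exactly to the transmitters $i\in I$. A $(2^{nR},n)$ code ($R\ge 0$) has independent uniform messages $W_I\in\{1,\dots,\lfloor 2^{nR_I}\rfloor\}$, encoders $x_i^n$ depending only on $(W_I)_{I\ni i}$, and a decoder that estimates all seven messages from $y^n$; its error probability is the probability that some estimate is wrong. $R$ is achievable if some sequence of $(2^{nR},n)$ codes has error probability tending to $0$. The capacity region $\mathcal C_p$ is the closure of the set of achievable rate vectors. For $R^*\in\mathbb R_+^7$ the $R^*$-multicast region is $\bigcap_{p\,:\,R^*\in\mathcal C_p}\mathcal C_p$. A universal encoding/decoding operation of length $n\ge1$ between $R^M\ne R^W$ (all $2^{nR^M_I},2^{nR^W_J}$ being integers) consists of maps by which each transmitter $i$ computes, from the messages $M_I\in\{1,\dots,2^{nR^M_I}\}$ with $I\ni i$, a value in $\{1,\dots,2^{nR^W_J}\}$ for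 each $J\ni i$, such that for every $J$ all transmitters in $J$ always obtain the same value $W_J$, and a decoding map with $\hat M(W(M))=M$ for all $M$. Its normalized difference vector is $(R^M-R^W)/\lVert R^M-R^W\rVert_2$. Such a vector $d$ is called distinct if it is not a finite linear combination, with nonnegative coefficients, of normalized difference vectors $\neq d$ of universal operations. Operations are counted by their normalized difference vectors. An extremal ray of a convex cone is a one-dimensional face of the form $\{tv:t\ge0\}$, $v\ne0$. Let $$G=\begin{bmatrix}1&0&0&1&1&0&1&1&1&1&1\\0&1&0&1&0&1&1&1&1&1&1\\0&0&1&0&1&1&1&1&1&1&1\\0&0&0&1&0&0&0&1&1&1&1\\0&0&0&0&1&0&1&0&1&1&1\\0&0&0&0&0&1&1&1&0&1&1\\0&0&0&0&0&0&0&0&0&0&1\end{bmatrix},\quad H=\begin{bmatrix}-1&-1&0&0&0&0&0&0&0&0\\0&0&-1&-1&0&0&0&0&0&0\\0&0&0&0&-1&-1&0&0&0&0\\1&0&1&0&0&0&-1&0&0&0\\0&1&0&0&1&0&0&-1&0&0\\0&0&0&1&0&1&0&0&-1&0\\0&0&0&0&0&0&1&1&1&-1\end{bmatrix}.$$ **Theorem.**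 For every $R^*\in\mathbb R_+^7$, the $R^*$-multicast region of the 3-user multiple access channel is $$\{R\in\mathbb R_+^7 : G^T(R-R^*)\preceq 0\},$$ i.e. the set of $R\in\mathbb R_+^7$ with $R-R^*$ in the cone $K=\{R\in\mathbb R^7:G^TR\preceq0\}$, and this region is a polytope (a bounded set defined by finitely many affine inequalities). The extremal rays of $K$ are exactly the rays spanned by the columns of $H$, and there are 10 of them. The normalized difference vectors of distinct universal encoding/decoding operations are exactly the normalized columns of $H$; thus there are 10 distinct universal operations. -/

import Mathlib

open Filter Topology Matrix

noncomputable section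

namespace MulticastMAC

/-- The seven message indices, in the order `1, 2, 3, 12, 13, 23, 123`, as sets of transmitters
(the transmitters `1, 2, 3` are `0, 1, 2 : Fin 3`). Message `I` is known exactly to the
transmitters in `users I`. -/
def users : Fin 7 → Finset (Fin 3) :=
  ![{0}, {1}, {2}, {0, 1}, {0, 2}, {1, 2}, {0, 1, 2}]

/-- A message vector for message sets of sizes `K I`. -/
abbrev Messages (K : Fin 7 → ℕ) : Type := ∀ I : Fin 7, Fin (K I)

/-- The messages available to transmitter `i`. -/
abbrev LocalMessages (K : Fin 7 → ℕ) (i : Fin 3) : Type :=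
  ∀ I : {I : Fin 7 // i ∈ users I}, Fin (K I)

/-- The part of a message vector that transmitter `i` sees. -/
def localPart {K : Fin 7 → ℕ} (w : Messages K) (i : Fin 3) : LocalMessages K i :=
  fun I => w I

/-- A discrete memoryless three-user multiple access channel with finite alphabets:
input alphabets `X i`, output alphabet `Y`, transition function `p x y = p(y | x₁, x₂, x₃)`. -/
structure MAC where
  X : Fin 3 → Type
  Y : Type
  [fintypeX : ∀ i, Fintype (X i)]
  [fintypeY : Fintype Y]
  p : (∀ i, X i) → Y → ℝ
  p_nonneg : ∀ x y, 0 ≤ p x y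
  p_sum : ∀ x, ∑ y, p x y = 1

attribute [instance] MAC.fintypeX MAC.fintypeY

/-- A block code of length `n` with message sets of sizes `K I`. Each transmitter encodes the
messages available to it; the receiver decodes all seven messages. -/
structure Code (ch : MAC) (K : Fin 7 → ℕ) (n : ℕ) where
  enc : ∀ i : Fin 3, LocalMessages K i → Fin n → ch.X i
  dec : (Fin n → ch.Y) → Messages K

open Classical in
/-- The probability that at least one decoded message differs from the transmitted one, when the
messages are independent and uniform and the channel is used `n` times without memory. -/
def Code.errorProb {ch : MAC} {K : Fin 7 → ℕ} {n : ℕ} (c : Code ch K n) : ℝ :=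
  (Fintype.card (Messages K) : ℝ)⁻¹ *
    ∑ w : Messages K, ∑ y : Fin n → ch.Y,
      if c.dec y ≠ w then ∏ t, ch.p (fun i => c.enc i (localPart w i) t) (y t) else 0

/-- The message set sizes `⌊2 ^ (n R_I)⌋` of a `(2 ^ (n R), n)` code. -/
def numMessages (R : Fin 7 → ℝ) (n : ℕ) (I : Fin 7) : ℕ :=
  ⌊(2 : ℝ) ^ ((n : ℝ) * R I)⌋₊

/-- The rate vector `R` is achievable on `ch`: some sequence of `(2 ^ (n R), n)` codes has error
probability tending to zero. -/
def Achievable (ch : MAC) (R : Fin 7 → ℝ) : Prop :=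
  0 ≤ R ∧ ∃ c : ∀ n : ℕ, Code ch (numMessages R n) n,
    Tendsto (fun n => (c n).errorProb) atTop (𝓝 0)

/-- The multicast capacity region: the closure of the set of achievable rate vectors. -/
def capacityRegion (ch : MAC) : Set (Fin 7 → ℝ) :=
  closure {R | Achievable ch R}

/-- The `Rstar`-multicast region: the intersection of the capacity regions of all channels whose
capacity region contains `Rstar`. -/
def multicastRegion (Rstar : Fin 7 → ℝ) : Set (Fin 7 → ℝ) :=
  ⋂ (ch : MAC) (_ : Rstar ∈ capacityRegion ch), capacityRegion ch

/-- The matrix `G_{MAC,3}`. -/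
def GMAC : Matrix (Fin 7) (Fin 11) ℝ :=
  !![1, 0, 0, 1, 1, 0, 1, 1, 1, 1, 1;
     0, 1, 0, 1, 0, 1, 1, 1, 1, 1, 1;
     0, 0, 1, 0, 1, 1, 1, 1, 1, 1, 1;
     0, 0, 0, 1, 0, 0, 0, 1, 1, 1, 1;
     0, 0, 0, 0, 1, 0, 1, 0, 1, 1, 1;
     0, 0, 0, 0, 0, 1, 1, 1, 0, 1, 1;
     0, 0, 0, 0, 0, 0, 0, 0, 0, 0, 1]

/-- The matrix `H_{MAC,3}`, with the sign for which its columns lie in the multicast cone. -/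
def HMAC : Matrix (Fin 7) (Fin 10) ℝ :=
  !![-1, -1,  0,  0,  0,  0,  0,  0,  0,  0;
      0,  0, -1, -1,  0,  0,  0,  0,  0,  0;
      0,  0,  0,  0, -1, -1,  0,  0,  0,  0;
      1,  0,  1,  0,  0,  0, -1,  0,  0,  0;
      0,  1,  0,  0,  1,  0,  0, -1,  0,  0;
      0,  0,  0,  1,  0,  1,  0,  0, -1,  0;
      0,  0,  0,  0,  0,  0,  1,  1,  1, -1]

/-- The multicast cone `{R : Gᵀ R ≤ 0}`. -/
def multicastCone : Set (Fin 7 → ℝ) :=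
  {R | GMACᵀ *ᵥ R ≤ 0}

/-- A polytope in `ℝ⁷`: a bounded set cut out by finitely many affine inequalities. -/
def IsPolytope (P : Set (Fin 7 → ℝ)) : Prop :=
  Bornology.IsBounded P ∧
    ∃ (m : ℕ) (A : Matrix (Fin m) (Fin 7) ℝ) (b : Fin m → ℝ), P = {x | A *ᵥ x ≤ b}

/-- The closed ray from the origin through `v`. -/
def ray (v : Fin 7 → ℝ) : Set (Fin 7 → ℝ) :=
  {x | ∃ t : ℝ, 0 ≤ t ∧ x = t • v}

/-- The extremal rays of a cone: its one-dimensional faces of the form `{t • v : t ≥ 0}`. -/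
def extremalRays (K : Set (Fin 7 → ℝ)) : Set (Set (Fin 7 → ℝ)) :=
  {r | (∃ v, v ≠ 0 ∧ r = ray v) ∧ IsExtreme ℝ K r}

/-- `v` divided by its Euclidean norm. -/
def normalize (v : Fin 7 → ℝ) : Fin 7 → ℝ :=
  (‖WithLp.toLp 2 v‖)⁻¹ • v

/-- A universal encoding/decoding operation of block length `n` for the multiple access channel:
it carries messages `M` of rates `RM` over channel messages `W` of rates `RW`. The message sets
have exactly `2 ^ (n R_I)` elements. Transmitter `i` computes every `W_J` with `i ∈ J` from the
messages `M_I` with `i ∈ I`; all transmitters in `J` agree on `W_J`; the receiver recovers `M`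
from `W`. -/
structure UniversalOperation (RM RW : Fin 7 → ℝ) (n : ℕ) where
  n_pos : 0 < n
  KM : Fin 7 → ℕ
  KW : Fin 7 → ℕ
  card_M : ∀ I, (KM I : ℝ) = (2 : ℝ) ^ ((n : ℝ) * RM I)
  card_W : ∀ J, (KW J : ℝ) = (2 : ℝ) ^ ((n : ℝ) * RW J)
  enc : ∀ (i : Fin 3) (J : {J : Fin 7 // i ∈ users J}), LocalMessages KM i → Fin (KW J)
  dec : Messages KW → Messages KM
  correct : ∀ M : Messages KM, ∃ W : Messages KW,
    (∀ (i : Fin 3) (J : {J : Fin 7 // i ∈ users J}), enc i J (localPart M i) = W J) ∧ dec W = M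

/-- `d` is the normalized difference vector of some universal encoding/decoding operation. -/
def HasUniversalOperation (d : Fin 7 → ℝ) : Prop :=
  ∃ (n : ℕ) (RM RW : Fin 7 → ℝ), RM ≠ RW ∧ Nonempty (UniversalOperation RM RW n) ∧
    d = normalize (RM - RW)

/-- `d` is the normalized difference vector of a distinct universal operation: it is not a linear
combination with nonnegative coefficients of normalized difference vectors other than `d`. -/
def IsDistinct (d : Fin 7 → ℝ) : Prop :=
  HasUniversalOperation d ∧
    ¬ ∃ (s : Finset (Fin 7 → ℝ)) (a : (Fin 7 → ℝ) → ℝ),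
      (∀ x ∈ s, HasUniversalOperation x ∧ x ≠ d ∧ 0 ≤ a x) ∧ d = ∑ x ∈ s, a x • x

end MulticastMAC

end

noncomputable section

namespace MulticastMAC

/-! The columns of `GMAC` are the indicators of the connected down-sets of message indices, so the
cone says that no down-set gains total rate. The columns of `HMAC` are the elementary exchanges:
carry a bit of a message on a channel message known to one transmitter fewer, or waste a bit of the
message known to all. `exists_nonneg_combination` (generators) and `mem_ray_of_tight` (extremality)
link the two descriptions by elementary linear algebra.

Direct part: every exchange can be applied to any code for any channel (`Code.exists_transfer`), so
each capacity region contains all nonnegative points of the shifted cone.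

Converse: for each down-set of `GMAC` a family of test channels gives the matching cut-set bound.
The channel `linkChannel` has seven parallel links; link `J` passes a symbol only if its
transmitters agree on it, and the whole output is erased with probability `1 - δ`. Alphabets are so
large that `δ * log (k J)` is just above the wanted rate of the link. Transmitters may agree by
chance on a symbol that depends on messages they do not share, but this leaks at most a bounded
number of nats per unerased use (`linkCost_pair`, `linkCost_triple`), hence `O(δ)` per use. As `δ →
0` the intended rates survive and the leakage vanishes (`sum_le_of_mem_multicastRegion`).

Universal operations: a common function of several transmitters depends only on commonly known
messages, so counting places every difference vector in the same cone. The elementary exchanges are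
such operations and span the extremal rays, which makes them exactly the distinct ones. -/

/-! ### The multicast cone: generators and extremal rays -/

/-- The columns of `HMAC`. -/
def hcol : Fin 10 → Fin 7 → ℝ :=
  ![![-1, 0, 0, 1, 0, 0, 0], ![-1, 0, 0, 0, 1, 0, 0], ![0, -1, 0, 1, 0, 0, 0],
    ![0, -1, 0, 0, 0, 1, 0], ![0, 0, -1, 0, 1, 0, 0], ![0, 0, -1, 0, 0, 1, 0],
    ![0, 0, 0, -1, 0, 0, 1], ![0, 0, 0, 0, -1, 0, 1], ![0, 0, 0, 0, 0, -1, 1],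
    ![0, 0, 0, 0, 0, 0, -1]]

theorem hcol_eq (j : Fin 10) : (fun I => HMAC I j) = hcol j := by
  funext I
  fin_cases j <;> fin_cases I <;> rfl

theorem GMAC_transpose_mulVec (R : Fin 7 → ℝ) : GMACᵀ *ᵥ R =
    ![R 0, R 1, R 2, R 0 + R 1 + R 3, R 0 + R 2 + R 4, R 1 + R 2 + R 5,
      R 0 + R 1 + R 2 + R 4 + R 5, R 0 + R 1 + R 2 + R 3 + R 5, R 0 + R 1 + R 2 + R 3 + R 4,
      R 0 + R 1 + R 2 + R 3 + R 4 + R 5, R 0 + R 1 + R 2 + R 3 + R 4 + R 5 + R 6] := by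
  funext k
  fin_cases k <;>
    simp [Matrix.mulVec, dotProduct, Fin.sum_univ_succ, GMAC, add_assoc, Fin.succ]

/-- The coordinate form of `Gᵀ R ≤ 0`. -/
theorem mulVec_le_zero_iff (R : Fin 7 → ℝ) : GMACᵀ *ᵥ R ≤ 0 ↔
    R 0 ≤ 0 ∧ R 1 ≤ 0 ∧ R 2 ≤ 0 ∧ R 0 + R 1 + R 3 ≤ 0 ∧ R 0 + R 2 + R 4 ≤ 0 ∧
    R 1 + R 2 + R 5 ≤ 0 ∧ R 0 + R 1 + R 2 + R 4 + R 5 ≤ 0 ∧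
    R 0 + R 1 + R 2 + R 3 + R 5 ≤ 0 ∧ R 0 + R 1 + R 2 + R 3 + R 4 ≤ 0 ∧
    R 0 + R 1 + R 2 + R 3 + R 4 + R 5 ≤ 0 ∧
    R 0 + R 1 + R 2 + R 3 + R 4 + R 5 + R 6 ≤ 0 := by
  rw [Pi.le_def, GMAC_transpose_mulVec]
  simp [Fin.forall_fin_succ, Fin.succ]

theorem mem_multicastCone_iff (R : Fin 7 → ℝ) :
    R ∈ multicastCone ↔ GMACᵀ *ᵥ R ≤ 0 := Iff.rfl

theorem hcol_mem (j : Fin 10) : hcol j ∈ multicastCone := by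
  rw [mem_multicastCone_iff, mulVec_le_zero_iff]
  fin_cases j <;> simp [hcol]

theorem hcol_ne_zero (j : Fin 10) : hcol j ≠ 0 := by
  fin_cases j <;> simp [hcol]

/-- The cone is generated by the columns of `HMAC`. -/
theorem exists_nonneg_combination {R : Fin 7 → ℝ} (hR : R ∈ multicastCone) :
    ∃ a : Fin 10 → ℝ, 0 ≤ a ∧ R = ∑ j, a j • hcol j := by
  rw [mem_multicastCone_iff, mulVec_le_zero_iff] at hR
  obtain ⟨h1, h2, h3, h4, h5, h6, h7, h8, h9, h10, h11⟩ := hR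
  -- Here `x`, `y`, `z` are the amounts moved from 1 to 12, from 2 to 23 and from 3 to 13; the rest
  -- of each singleton goes to its other pair. The last three inequalities say that no pair receives
  -- less than it needs.
  obtain ⟨x, y, z, hx0, hx1, hy0, hy1, hz0, hz1, hxy, hzx, hyz⟩ : ∃ x y z : ℝ,
      0 ≤ x ∧ x ≤ -R 0 ∧ 0 ≤ y ∧ y ≤ -R 1 ∧ 0 ≤ z ∧ z ≤ -R 2 ∧
      R 3 + R 1 ≤ x - y ∧ R 4 + R 0 ≤ z - x ∧ R 5 + R 2 ≤ y - z := by
    have key (a b : ℝ) :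
        0 ≤ max 0 (max a (a + b)) ∧ a ≤ max 0 (max a (a + b)) ∧ a + b ≤ max 0 (max a (a + b)) ∧
          ∀ c, 0 ≤ c → a ≤ c → a + b ≤ c → max 0 (max a (a + b)) ≤ c := by
      refine ⟨le_max_left _ _, ?_, ?_, fun c h0 h1 h2 => max_le h0 (max_le h1 h2)⟩ <;> simp
    obtain ⟨x0, xa, xb, hx⟩ := key (R 3 + R 1) (R 5 + R 2)
    obtain ⟨y0, ya, yb, hy⟩ := key (R 5 + R 2) (R 4 + R 0)
    obtain ⟨z0, za, zb, hz⟩ := key (R 4 + R 0) (R 3 + R 1)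
    -- The least solution of a cyclic system of difference constraints, as longest path lengths. The
    -- inequality for the down-set of all singletons and pairs excludes a positive cycle; the
    -- smaller down-sets give the upper bounds.
    refine ⟨_, _, _, x0, hx _ ?_ ?_ ?_, y0, hy _ ?_ ?_ ?_, z0, hz _ ?_ ?_ ?_,
      le_sub_comm.1 (hy _ ?_ ?_ ?_), le_sub_comm.1 (hx _ ?_ ?_ ?_),
      le_sub_comm.1 (hz _ ?_ ?_ ?_)⟩ <;> linarith
  refine ⟨![x, -R 0 - x, -R 1 - y, y, z, -R 2 - z, x - y - R 3 - R 1, z - x - R 4 - R 0,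
    y - z - R 5 - R 2, -(R 0 + R 1 + R 2 + R 3 + R 4 + R 5 + R 6)], ?_, ?_⟩
  · rw [Pi.le_def]
    simp only [Fin.forall_fin_succ]
    simp [Fin.succ]
    refine ⟨?_, ?_, ?_, ?_, ?_, ?_, ?_, ?_, ?_, ?_⟩ <;> linarith
  · ext I
    fin_cases I <;> simp [Fin.sum_univ_succ, hcol, Fin.succ] <;> ring

/-- A point of the cone at which all inequalities tight at `hcol j` are tight lies on the ray
through `hcol j`. -/
theorem mem_ray_of_tight (j : Fin 10) {x : Fin 7 → ℝ} (hx : x ∈ multicastCone)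
    (ht : ∀ k, (GMACᵀ *ᵥ hcol j) k = 0 → (GMACᵀ *ᵥ x) k = 0) : x ∈ ray (hcol j) := by
  rw [mem_multicastCone_iff, mulVec_le_zero_iff] at hx
  simp only [GMAC_transpose_mulVec, Fin.forall_fin_succ] at ht
  -- The listed index is the coordinate at which `hcol j` equals `-1`.
  refine ⟨-x (![0, 0, 1, 1, 2, 2, 3, 4, 5, 6] j), ?_, ?_⟩
  · fin_cases j <;> simp <;> simp [hcol, Fin.succ] at ht <;> linarith
  · ext I
    fin_cases j <;> simp [hcol, Fin.succ] at ht ⊢ <;> fin_cases I <;> simp <;> linarith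

theorem smul_mem_cone {t : ℝ} (ht : 0 ≤ t) {x : Fin 7 → ℝ} (hx : x ∈ multicastCone) :
    t • x ∈ multicastCone := by
  rw [mem_multicastCone_iff] at *
  rw [Matrix.mulVec_smul]
  exact smul_nonpos_of_nonneg_of_nonpos ht hx

theorem add_mem_cone {x y : Fin 7 → ℝ} (hx : x ∈ multicastCone) (hy : y ∈ multicastCone) :
    x + y ∈ multicastCone := by
  rw [mem_multicastCone_iff] at *
  rw [Matrix.mulVec_add]
  exact add_nonpos hx hy

theorem ray_subset_cone {x : Fin 7 → ℝ} (hx : x ∈ multicastCone) : ray x ⊆ multicastCone := by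
  rintro _ ⟨t, ht, rfl⟩
  exact smul_mem_cone ht hx

theorem ray_smul {s : ℝ} (hs : 0 < s) (v : Fin 7 → ℝ) : ray (s • v) = ray v := by
  ext x
  constructor
  · rintro ⟨t, ht, rfl⟩
    exact ⟨t * s, by positivity, by rw [smul_smul]⟩
  · rintro ⟨t, ht, rfl⟩
    exact ⟨t / s, by positivity, by rw [smul_smul, div_mul_cancel₀ _ hs.ne']⟩

/-- A functional that is nonpositive on the cone and vanishes inside a segment vanishes at its ends,
so both ends satisfy the tight equations of `hcol j`. -/
theorem ray_hcol_isExtreme (j : Fin 10) : IsExtreme ℝ multicastCone (ray (hcol j)) := by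
  refine ⟨ray_subset_cone (hcol_mem j), ?_⟩
  rintro x hx y hy z ⟨c, hc, rfl⟩ ⟨a, b, ha, hb, -, hz⟩
  refine mem_ray_of_tight j hx fun k hk => ?_
  have h1 := hx k
  have h2 := hy k
  have h3 : (GMACᵀ *ᵥ (a • x + b • y)) k = 0 := by
    rw [hz, Matrix.mulVec_smul, Pi.smul_apply, hk, smul_zero]
  rw [Matrix.mulVec_add, Matrix.mulVec_smul, Matrix.mulVec_smul] at h3
  simp only [Pi.add_apply, Pi.smul_apply, smul_eq_mul, Pi.zero_apply] at h1 h2 h3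
  refine le_antisymm h1 ?_
  by_contra hlt
  have := mul_neg_of_pos_of_neg ha (not_le.1 hlt)
  have := mul_nonpos_of_nonneg_of_nonpos hb.le h2
  linarith

theorem exists_ray_hcol_of_isExtreme {v : Fin 7 → ℝ} (hv : v ≠ 0)
    (hr : IsExtreme ℝ multicastCone (ray v)) : ∃ j, ray (hcol j) = ray v := by
  have hvK : v ∈ multicastCone := hr.subset ⟨1, zero_le_one, (one_smul _ _).symm⟩
  obtain ⟨a, ha, hsum⟩ := exists_nonneg_combination hvK
  obtain ⟨j, hj⟩ : ∃ j, a j ≠ 0 := by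
    by_contra! h
    exact hv (by simp [hsum, h])
  have haj : 0 < a j := lt_of_le_of_ne (ha j) hj.symm
  -- `v` is the midpoint of twice its `j`-th term and twice the remaining sum, both in the cone.
  have hmem : (2 * a j) • hcol j ∈ ray v := by
    refine hr.left_mem_of_mem_openSegment (smul_mem_cone (by positivity) (hcol_mem j))
      (y := (2 : ℝ) • ∑ i ∈ Finset.univ.erase j, a i • hcol i) ?_
      (z := v) ⟨1, zero_le_one, (one_smul _ _).symm⟩
      ⟨1 / 2, 1 / 2, by norm_num, by norm_num, by norm_num, ?_⟩
    · refine smul_mem_cone zero_le_two ?_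
      refine Finset.sum_induction _ (· ∈ multicastCone) (fun _ _ => add_mem_cone) ?_
        fun i _ => smul_mem_cone (ha i) (hcol_mem i)
      simp [multicastCone]
    · rw [smul_smul, smul_smul, hsum, ← Finset.add_sum_erase _ _ (Finset.mem_univ j),
        one_div, inv_mul_cancel_left₀ two_ne_zero, inv_mul_cancel₀ two_ne_zero, one_smul]
  obtain ⟨t, ht, e⟩ := hmem
  have ht0 : t ≠ 0 := by
    rintro rfl
    rw [zero_smul, smul_eq_zero] at e
    rcases e with e | e
    · linarith
    · exact hcol_ne_zero j e
  refine ⟨j, ?_⟩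
  rw [← ray_smul (s := 2 * a j) (by positivity) (hcol j), e,
    ray_smul (lt_of_le_of_ne ht ht0.symm)]

theorem extremalRays_multicastCone :
    extremalRays multicastCone = Set.range (fun j => ray (hcol j)) := by
  ext r
  constructor
  · rintro ⟨⟨v, hv, rfl⟩, hr⟩
    obtain ⟨j, hj⟩ := exists_ray_hcol_of_isExtreme hv hr
    exact ⟨j, hj⟩
  · rintro ⟨j, rfl⟩
    exact ⟨⟨_, hcol_ne_zero j, rfl⟩, ray_hcol_isExtreme j⟩

theorem eq_of_hcol_mem_ray {i j : Fin 10} (h : hcol i ∈ ray (hcol j)) : i = j := by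
  obtain ⟨t, ht, e⟩ := h
  fin_cases i <;> fin_cases j <;>
    first | rfl | (exfalso; simp [hcol] at e; try linarith)

theorem ray_hcol_injective : Function.Injective (fun j => ray (hcol j)) := by
  intro i j h
  refine eq_of_hcol_mem_ray ?_
  rw [show ray (hcol j) = ray (hcol i) from h.symm]
  exact ⟨1, zero_le_one, (one_smul _ _).symm⟩

/-! ### Universal operations and distinctness -/

/-- `S` is closed under passing to messages available to fewer transmitters. -/
def IsDownSet (S : Finset (Fin 7)) : Prop :=
  ∀ I ∈ S, ∀ J, users J ⊆ users I → J ∈ S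

theorem norm_toLp_pos {v : Fin 7 → ℝ} (hv : v ≠ 0) : 0 < ‖WithLp.toLp 2 v‖ := by
  rw [norm_pos_iff]
  intro h
  exact hv (by simpa using congrArg WithLp.ofLp h)

theorem normalize_smul {t : ℝ} (ht : 0 < t) (v : Fin 7 → ℝ) : normalize (t • v) = normalize v := by
  unfold normalize
  rw [WithLp.toLp_smul, norm_smul, Real.norm_of_nonneg ht.le, smul_smul, mul_inv,
    mul_right_comm, inv_mul_cancel₀ ht.ne', one_mul]

theorem normalize_ne_zero {v : Fin 7 → ℝ} (hv : v ≠ 0) : normalize v ≠ 0 :=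
  smul_ne_zero (inv_ne_zero (norm_toLp_pos hv).ne') hv

theorem normalize_normalize {v : Fin 7 → ℝ} (hv : v ≠ 0) : normalize (normalize v) = normalize v :=
  normalize_smul (inv_pos.2 (norm_toLp_pos hv)) v

theorem UniversalOperation.pos_M {RM RW : Fin 7 → ℝ} {n : ℕ} (o : UniversalOperation RM RW n)
    (I : Fin 7) : 0 < o.KM I := by
  have := o.card_M I
  have h : (0 : ℝ) < o.KM I := this ▸ by positivity
  exact_mod_cast h

/-- If all transmitters of `users J` can compute the same function of the messages, then this
function depends only on the messages known to all of them. -/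
theorem eq_of_common_knowledge {K : Fin 7 → ℕ} {α : Type*} (J : Fin 7) (f : Messages K → α)
    (hf : ∀ i ∈ users J, ∃ g : LocalMessages K i → α, ∀ v, f v = g (localPart v i))
    {v v' : Messages K} (h : ∀ I, users J ⊆ users I → v I = v' I) : f v = f v' := by
  classical
  suffices H : ∀ T : Finset (Fin 3), T ⊆ users J → ∀ v v' : Messages K,
      (∀ I, T ⊆ users I → v I = v' I) → f v = f v' from H _ subset_rfl _ _ h
  intro T
  induction T using Finset.induction_on with
  | empty => intro _ v v' h; rw [show v = v' from funext fun I => h I (Finset.empty_subset _)]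
  | insert a T ha ih =>
    intro hT v v' h
    obtain ⟨g, hg⟩ := hf a (hT (Finset.mem_insert_self _ _))
    -- A hybrid vector: transmitter `a` cannot tell it from `v`, and it differs from `v'` only at
    -- messages that `a` knows.
    let v'' : Messages K := fun I => if a ∈ users I then v I else v' I
    have h1 : f v = f v'' := by
      rw [hg, hg]
      congr 1
      funext I
      simp [localPart, v'', I.2]
    rw [h1]
    refine ih ((Finset.subset_insert _ _).trans hT) _ _ fun I hI => ?_
    by_cases haI : a ∈ users I
    · simpa [v'', haI] using h I (Finset.insert_subset haI hI)
    · simp [v'', haI]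

/-- Counting bound: the messages in a down-set are determined by the channel messages in it, once
the other messages are fixed. -/
theorem UniversalOperation.prod_le {RM RW : Fin 7 → ℝ} {n : ℕ} (o : UniversalOperation RM RW n)
    {S : Finset (Fin 7)} (hS : IsDownSet S) : ∏ I ∈ S, o.KM I ≤ ∏ I ∈ S, o.KW I := by
  classical
  choose W hW hdec using o.correct
  let ext (u : ∀ I : S, Fin (o.KM I)) : Messages o.KM :=
    fun I => if h : I ∈ S then u ⟨I, h⟩ else ⟨0, o.pos_M I⟩
  have key : Function.Injective
      (fun (u : ∀ I : S, Fin (o.KM I)) => (fun J : S => W (ext u) J : ∀ I : S, Fin (o.KW I))) := by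
    intro u u' h
    -- Outside `S` the channel messages agree automatically: as `S` is a down-set, they depend only
    -- on messages outside `S`, which `ext` fixes.
    have hWW : W (ext u) = W (ext u') := by
      funext J
      by_cases hJ : J ∈ S
      · exact congrFun h ⟨J, hJ⟩
      · refine eq_of_common_knowledge J (fun v => W v J)
          (fun i hi => ⟨o.enc i ⟨J, hi⟩, fun v => (hW v i ⟨J, hi⟩).symm⟩) fun I hI => ?_
        have : I ∉ S := fun hI' => hJ (hS I hI' J hI)
        simp [ext, this]
    have he : ext u = ext u' := by rw [← hdec (ext u), hWW, hdec]
    funext I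
    have := congrFun he I
    simpa [ext] using this
  have := Fintype.card_le_of_injective _ key
  simp only [Fintype.card_pi, Fintype.card_fin] at this
  rwa [Finset.prod_coe_sort S o.KM, Finset.prod_coe_sort S o.KW] at this

theorem UniversalOperation.sum_le {RM RW : Fin 7 → ℝ} {n : ℕ} (o : UniversalOperation RM RW n)
    {S : Finset (Fin 7)} (hS : IsDownSet S) : ∑ I ∈ S, RM I ≤ ∑ I ∈ S, RW I := by
  have h : (∏ I ∈ S, (o.KM I : ℝ)) ≤ ∏ I ∈ S, (o.KW I : ℝ) := by exact_mod_cast o.prod_le hS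
  simp only [o.card_M, o.card_W, ← Real.rpow_sum_of_pos (zero_lt_two' ℝ), ← Finset.mul_sum] at h
  have hn : (0 : ℝ) < n := by exact_mod_cast o.n_pos
  exact le_of_mul_le_mul_left ((Real.rpow_le_rpow_left_iff one_lt_two).1 h) hn

theorem UniversalOperation.sub_mem_cone {RM RW : Fin 7 → ℝ} {n : ℕ}
    (o : UniversalOperation RM RW n) : RM - RW ∈ multicastCone := by
  have h (S : Finset (Fin 7)) (hS : IsDownSet S) := o.sum_le hS
  rw [mem_multicastCone_iff, mulVec_le_zero_iff]
  have h1 := h {0} (by unfold IsDownSet; decide)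
  have h2 := h {1} (by unfold IsDownSet; decide)
  have h3 := h {2} (by unfold IsDownSet; decide)
  have h4 := h {0, 1, 3} (by unfold IsDownSet; decide)
  have h5 := h {0, 2, 4} (by unfold IsDownSet; decide)
  have h6 := h {1, 2, 5} (by unfold IsDownSet; decide)
  have h7 := h {0, 1, 2, 4, 5} (by unfold IsDownSet; decide)
  have h8 := h {0, 1, 2, 3, 5} (by unfold IsDownSet; decide)
  have h9 := h {0, 1, 2, 3, 4} (by unfold IsDownSet; decide)
  have h10 := h {0, 1, 2, 3, 4, 5} (by unfold IsDownSet; decide)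
  have h11 := h {0, 1, 2, 3, 4, 5, 6} (by unfold IsDownSet; decide)
  simp [Finset.sum_insert, Finset.sum_singleton] at h1 h2 h3 h4 h5 h6 h7 h8 h9 h10 h11 ⊢
  refine ⟨?_, ?_, ?_, ?_, ?_, ?_, ?_, ?_, ?_, ?_, ?_⟩ <;> linarith

/-- Carrying one bit of message `J` over the channel message `I`, for `users I ⊆ users J`. -/
theorem hasUniversalOperation_single_sub_single {I J : Fin 7} (hIJ : users I ⊆ users J)
    (hne : I ≠ J) :
    HasUniversalOperation (normalize (Pi.single J 1 - Pi.single I 1)) := by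
  have hcard (A B : Fin 7) : (((if B = A then 2 else 1 : ℕ)) : ℝ) =
      2 ^ (((1 : ℕ) : ℝ) * (Pi.single A 1 : Fin 7 → ℝ) B) := by
    by_cases h : B = A <;> simp [h]
  refine ⟨1, Pi.single J 1, Pi.single I 1, ?_, ⟨⟨one_pos, fun B => if B = J then 2 else 1,
    fun B => if B = I then 2 else 1, hcard J, hcard I,
    fun i A M => if h : (A : Fin 7) = I then
      ⟨M ⟨J, hIJ (h ▸ A.2)⟩, by have := (M ⟨J, hIJ (h ▸ A.2)⟩).2; simpa [h] using this⟩
      else ⟨0, by simp [h]⟩,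
    fun W B => if h : B = J then ⟨W I, by have := (W I).2; simpa [h] using this⟩
      else ⟨0, by simp [h]⟩, ?_⟩⟩, rfl⟩
  · intro h
    have := congrFun h J
    simp [hne.symm] at this
  · intro M
    refine ⟨fun A => if h : A = I then ⟨M J, by have := (M J).2; simpa [h] using this⟩
      else ⟨0, by simp [h]⟩, ?_, ?_⟩
    · intro i A
      simp only [localPart]
    · funext B
      by_cases h : B = J
      · subst h; simp
      · simp only [h, dite_false]
        have := (M B).2
        simp only [h, if_false] at this
        apply Fin.ext
        simp
        lia

/-- Leaving one bit of a channel message unused. -/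
theorem hasUniversalOperation_neg_single (I : Fin 7) :
    HasUniversalOperation (normalize (-Pi.single I 1)) := by
  have hpos (A : Fin 7) : 0 < if A = I then 2 else 1 := by split_ifs <;> simp
  refine ⟨1, 0, Pi.single I 1, ?_, ⟨⟨one_pos, fun _ => 1, fun B => if B = I then 2 else 1,
    by simp, ?_, fun i A M => ⟨0, hpos A⟩, fun _ _ => 0, ?_⟩⟩, by simp⟩
  · intro h
    simpa using congrFun h I
  · intro B
    by_cases h : B = I <;> simp [h]
  · exact fun M => ⟨fun A => ⟨0, hpos A⟩, fun _ _ => rfl,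
      funext fun B => Subsingleton.elim _ _⟩

theorem hasUniversalOperation_hcol (j : Fin 10) : HasUniversalOperation (normalize (hcol j)) := by
  have h (I J : Fin 7) (hIJ : users I ⊆ users J) (hne : I ≠ J)
      (e : hcol j = Pi.single J 1 - Pi.single I 1) : HasUniversalOperation (normalize (hcol j)) :=
    e ▸ hasUniversalOperation_single_sub_single hIJ hne
  fin_cases j
  · refine h 0 3 (by decide) (by decide) ?_
    ext I; fin_cases I <;> simp [hcol]
  · refine h 0 4 (by decide) (by decide) ?_
    ext I; fin_cases I <;> simp [hcol]
  · refine h 1 3 (by decide) (by decide) ?_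
    ext I; fin_cases I <;> simp [hcol]
  · refine h 1 5 (by decide) (by decide) ?_
    ext I; fin_cases I <;> simp [hcol]
  · refine h 2 4 (by decide) (by decide) ?_
    ext I; fin_cases I <;> simp [hcol]
  · refine h 2 5 (by decide) (by decide) ?_
    ext I; fin_cases I <;> simp [hcol]
  · refine h 3 6 (by decide) (by decide) ?_
    ext I; fin_cases I <;> simp [hcol]
  · refine h 4 6 (by decide) (by decide) ?_
    ext I; fin_cases I <;> simp [hcol]
  · refine h 5 6 (by decide) (by decide) ?_
    ext I; fin_cases I <;> simp [hcol]
  · rw [show hcol ((fun i => i) ⟨9, by decide⟩) = -Pi.single 6 1 by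
      ext I; fin_cases I <;> simp [hcol]]
    exact hasUniversalOperation_neg_single 6

theorem HasUniversalOperation.mem_cone {d : Fin 7 → ℝ} (h : HasUniversalOperation d) :
    d ∈ multicastCone := by
  obtain ⟨n, RM, RW, -, ⟨o⟩, rfl⟩ := h
  exact smul_mem_cone (by positivity) o.sub_mem_cone

theorem HasUniversalOperation.normalize_eq {d : Fin 7 → ℝ} (h : HasUniversalOperation d) :
    d ≠ 0 ∧ normalize d = d := by
  obtain ⟨n, RM, RW, hne, -, rfl⟩ := h
  exact ⟨normalize_ne_zero (sub_ne_zero.2 hne), normalize_normalize (sub_ne_zero.2 hne)⟩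

theorem normalize_eq_of_mem_ray {x v : Fin 7 → ℝ} (hx : x ≠ 0) (h : x ∈ ray v) :
    normalize x = normalize v := by
  obtain ⟨t, ht, rfl⟩ := h
  exact normalize_smul (lt_of_le_of_ne ht fun h => hx (by simp [← h])) v

/-- By extremality, every term with nonzero coefficient in a conic combination lies on the ray
itself, so its unit vector would be the excluded one. All terms then vanish, which a unit vector
cannot allow. -/
theorem isDistinct_hcol (j : Fin 10) : IsDistinct (normalize (hcol j)) := by
  refine ⟨hasUniversalOperation_hcol j, ?_⟩
  rintro ⟨s, a, hs, hsum⟩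
  refine normalize_ne_zero (hcol_ne_zero j) ?_
  rw [hsum]
  refine Finset.sum_eq_zero fun x hx => ?_
  obtain ⟨hop, hne, hax⟩ := hs x hx
  by_contra hax0
  refine hne ?_
  rw [← hop.normalize_eq.2]
  refine normalize_eq_of_mem_ray hop.normalize_eq.1 (mem_ray_of_tight j hop.mem_cone fun k hk => ?_)
  have h0 : ∑ y ∈ s, a y * (GMACᵀ *ᵥ y) k = 0 := by
    have : (GMACᵀ *ᵥ normalize (hcol j)) k = 0 := by
      rw [normalize, Matrix.mulVec_smul, Pi.smul_apply, hk, smul_zero]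
    rw [hsum, Matrix.mulVec_sum, Finset.sum_apply] at this
    simpa [Matrix.mulVec_smul] using this
  have h1 := (Finset.sum_eq_zero_iff_of_nonpos fun y hy =>
    mul_nonpos_of_nonneg_of_nonpos (hs y hy).2.2 ((hs y hy).1.mem_cone k)).1 h0 x hx
  refine (mul_eq_zero.1 h1).resolve_left fun h => hax0 ?_
  rw [h, zero_smul]

theorem normalize_hcol_injective : Function.Injective (fun j => normalize (hcol j)) := by
  intro i j h
  refine eq_of_hcol_mem_ray ⟨‖WithLp.toLp 2 (hcol i)‖ * ‖WithLp.toLp 2 (hcol j)‖⁻¹,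
    by positivity, ?_⟩
  have h : ‖WithLp.toLp 2 (hcol i)‖⁻¹ • hcol i = ‖WithLp.toLp 2 (hcol j)‖⁻¹ • hcol j := h
  rw [mul_smul, ← h, smul_inv_smul₀ (norm_toLp_pos (hcol_ne_zero i)).ne']

/-- A difference vector that is not a normalized generator is a conic combination of the generators,
all of which differ from it. -/
theorem setOf_isDistinct : {d | IsDistinct d} = Set.range (fun j => normalize (hcol j)) := by
  classical
  ext d
  constructor
  · rintro ⟨hd, hnot⟩
    by_contra hrange
    obtain ⟨a, ha, hsum⟩ := exists_nonneg_combination hd.mem_cone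
    have hinj := normalize_hcol_injective
    refine hnot ⟨Finset.univ.image fun j => normalize (hcol j),
      Function.extend (fun j => normalize (hcol j))
        (fun j => a j * ‖WithLp.toLp 2 (hcol j)‖) 0, ?_, ?_⟩
    · intro x hx
      obtain ⟨j, -, rfl⟩ := Finset.mem_image.1 hx
      refine ⟨hasUniversalOperation_hcol j, fun h => hrange ⟨j, h⟩, ?_⟩
      rw [hinj.extend_apply]
      exact mul_nonneg (ha j) (norm_nonneg _)
    · rw [Finset.sum_image fun _ _ _ _ h => hinj h, hsum]
      refine Finset.sum_congr rfl fun j _ => ?_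
      rw [hinj.extend_apply, normalize, mul_smul,
        smul_inv_smul₀ (norm_toLp_pos (hcol_ne_zero j)).ne']
  · rintro ⟨j, rfl⟩
    exact isDistinct_hcol j

/-! ### Direct part: transforming codes and capacity regions -/

theorem Code.errorProb_nonneg {ch : MAC} {K : Fin 7 → ℕ} {n : ℕ} (c : Code ch K n) :
    0 ≤ c.errorProb := by
  unfold Code.errorProb
  refine mul_nonneg (by positivity) (Finset.sum_nonneg fun w _ => Finset.sum_nonneg fun y _ => ?_)
  split_ifs
  · exact Finset.prod_nonneg fun t _ => ch.p_nonneg _ _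
  · rfl

/-- A code for message sets `K` yields one for message sets `K'`, if `K'`-messages can be carried
by `K`-messages computed locally at each transmitter. -/
theorem Code.exists_transfer {ch : MAC} {K K' : Fin 7 → ℕ} {n : ℕ} (c : Code ch K n)
    (hK : ∀ I, 0 < K I) (hK' : ∀ I, 0 < K' I)
    (φ : Messages K' → Messages K) (ψ : Messages K → Messages K') (hψ : ∀ m, ψ (φ m) = m)
    (hφ : ∀ i m m', localPart m i = localPart m' i → localPart (φ m) i = localPart (φ m') i) :
    ∃ c' : Code ch K' n, c'.errorProb ≤ c.errorProb := by
  classical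
  have : ∀ I, NeZero (K I) := fun I => ⟨(hK I).ne'⟩
  have : ∀ I, NeZero (K' I) := fun I => ⟨(hK' I).ne'⟩
  have hg (i : Fin 3) : ∃ g : LocalMessages K' i → LocalMessages K i,
      ∀ m, localPart (φ m) i = g (localPart m i) := by
    obtain ⟨g, hg⟩ := (Function.factorsThrough_iff (f := fun m => localPart m i)
      (fun m => localPart (φ m) i)).1 fun m m' h => hφ i m m' h
    exact ⟨g, fun m => congrFun hg m⟩
  choose g hg using hg
  -- `c` is only good on average, and possibly bad on the image of `φ`. A shift `s` known to all
  -- terminals cures this: for fixed `m`, `φ m + s` is uniform when `s` is, so the average error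
  -- over `s` is at most that of `c`. The shift acts coordinatewise, hence locally.
  let cs (s : Messages K) : Code ch K' n :=
    { enc := fun i l => c.enc i (g i l + localPart s i)
      dec := fun y => ψ (c.dec y - s) }
  let e (w : Messages K) : ℝ := ∑ y : Fin n → ch.Y,
    if c.dec y ≠ w then ∏ t, ch.p (fun i => c.enc i (localPart w i) t) (y t) else 0
  have hc : c.errorProb = (Fintype.card (Messages K) : ℝ)⁻¹ * ∑ w, e w := by
    unfold Code.errorProb
    simp only [e]
  have hcs (s : Messages K) : (cs s).errorProb ≤
      (Fintype.card (Messages K') : ℝ)⁻¹ * ∑ m, e (φ m + s) := by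
    unfold Code.errorProb
    refine mul_le_mul_of_nonneg_left (Finset.sum_le_sum fun m _ => Finset.sum_le_sum fun y _ => ?_)
      (by positivity)
    have henc (t) : (fun i => (cs s).enc i (localPart m i) t) =
        fun i => c.enc i (localPart (φ m + s) i) t := by
      funext i
      have : localPart (φ m + s) i = localPart (φ m) i + localPart s i := rfl
      rw [this, hg]
    simp only [henc]
    split_ifs with h1 h2 h2
    · rfl
    · refine absurd ?_ h1
      show ψ (c.dec y - s) = m
      rw [not_not.1 h2, add_sub_cancel_right, hψ]
    · exact Finset.prod_nonneg fun t _ => ch.p_nonneg _ _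
    · rfl
  have hcard : (0 : ℝ) < Fintype.card (Messages K) := by exact_mod_cast Fintype.card_pos
  have hcard' : (0 : ℝ) < Fintype.card (Messages K') := by exact_mod_cast Fintype.card_pos
  have hsum : ∑ s : Messages K, (cs s).errorProb ≤ ∑ s : Messages K, c.errorProb := by
    calc _ ≤ ∑ s, (Fintype.card (Messages K') : ℝ)⁻¹ * ∑ m, e (φ m + s) :=
          Finset.sum_le_sum fun s _ => hcs s
      _ = (Fintype.card (Messages K') : ℝ)⁻¹ * ∑ m : Messages K', ∑ s, e (φ m + s) := by
          rw [← Finset.mul_sum, Finset.sum_comm]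
      _ = (Fintype.card (Messages K') : ℝ)⁻¹ * ∑ m : Messages K', ∑ s, e s := by
          congr 1
          exact Finset.sum_congr rfl fun m _ => Equiv.sum_comp (Equiv.addLeft (φ m)) e
      _ = ∑ s, c.errorProb := by
          rw [Finset.sum_const, Finset.sum_const, hc, nsmul_eq_mul, nsmul_eq_mul,
            Finset.card_univ, Finset.card_univ, inv_mul_cancel_left₀ hcard'.ne',
            mul_inv_cancel_left₀ hcard.ne']
  obtain ⟨s, -, hs⟩ := Finset.exists_le_of_sum_le Finset.univ_nonempty hsum
  exact ⟨cs s, hs⟩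

theorem numMessages_pos {R : Fin 7 → ℝ} (hR : 0 ≤ R) (n : ℕ) (I : Fin 7) :
    0 < numMessages R n I := by
  refine Nat.floor_pos.2 (Real.one_le_rpow one_le_two ?_)
  exact mul_nonneg (Nat.cast_nonneg _) (hR I)

theorem Achievable.transfer {ch : MAC} {R R' : Fin 7 → ℝ} (h : Achievable ch R) (hR' : 0 ≤ R')
    (H : ∀ᶠ n in atTop, ∀ c : Code ch (numMessages R n) n,
      ∃ c' : Code ch (numMessages R' n) n, c'.errorProb ≤ c.errorProb) : Achievable ch R' := by
  classical
  obtain ⟨hR, c, hc⟩ := h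
  have hex (n : ℕ) : ∃ c' : Code ch (numMessages R' n) n,
      (∀ c : Code ch (numMessages R n) n,
        ∃ c' : Code ch (numMessages R' n) n, c'.errorProb ≤ c.errorProb) →
      c'.errorProb ≤ (c n).errorProb := by
    by_cases hn : ∀ c : Code ch (numMessages R n) n,
        ∃ c' : Code ch (numMessages R' n) n, c'.errorProb ≤ c.errorProb
    · obtain ⟨c', h⟩ := hn (c n)
      exact ⟨c', fun _ => h⟩
    -- For the exceptional `n` any code serves; its input letters are borrowed from `c n`, as the
    -- alphabets are not assumed nonempty.
    · exact ⟨⟨fun i _ => (c n).enc i fun I => ⟨0, numMessages_pos hR n I⟩,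
        fun _ I => ⟨0, numMessages_pos hR' n I⟩⟩, fun h => absurd h hn⟩
  choose c' hc' using hex
  refine ⟨hR', c', squeeze_zero' (Eventually.of_forall fun n => (c' n).errorProb_nonneg) ?_ hc⟩
  filter_upwards [H] with n hn using hc' n hn

theorem Achievable.mono {ch : MAC} {R R' : Fin 7 → ℝ} (h : Achievable ch R) (hR' : 0 ≤ R')
    (hle : R' ≤ R) : Achievable ch R' := by
  have hR := h.1
  refine h.transfer hR' (Eventually.of_forall fun n c => ?_)
  have hK (I : Fin 7) : numMessages R' n I ≤ numMessages R n I := by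
    refine Nat.floor_mono (Real.rpow_le_rpow_of_exponent_le one_le_two ?_)
    exact mul_le_mul_of_nonneg_left (hle I) (Nat.cast_nonneg _)
  refine c.exists_transfer (numMessages_pos hR n) (numMessages_pos hR' n)
    (fun m I => Fin.castLE (hK I) (m I))
    (fun w I => if h : (w I : ℕ) < numMessages R' n I then ⟨w I, h⟩
      else ⟨0, numMessages_pos hR' n I⟩) (fun m => ?_) (fun i m m' h => ?_)
  · funext I
    simp
  · funext I
    have := congrFun h I
    simp only [localPart] at this ⊢
    rw [this]

/-- Message `J` is split by division by `K J`: the remainder stays on `J`, and the quotient, below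
`L`, becomes the last base-`L` digit of what is sent on `I`. Transmitters of `I` know `J`, so the
encoding is local. -/
theorem Code.exists_transfer_move {ch : MAC} {K K' : Fin 7 → ℕ} {n : ℕ} (c : Code ch K n)
    (hK : ∀ I, 0 < K I) (hK' : ∀ I, 0 < K' I) {I J : Fin 7} (hIJ : users I ⊆ users J)
    (hne : I ≠ J) {L : ℕ} (hJ : K' J ≤ K J * L) (hI : K' I * L ≤ K I)
    (hle : ∀ A, A ≠ I → A ≠ J → K' A ≤ K A) :
    ∃ c' : Code ch K' n, c'.errorProb ≤ c.errorProb := by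
  have hL : 0 < L := Nat.pos_of_ne_zero fun h => by
    have := hK' J
    rw [h, mul_zero] at hJ
    lia
  have hbound (m : Messages K') (A : Fin 7) : (if A = I then m I * L + m J / K J
      else if A = J then m J % K J else (m A : ℕ)) < K A := by
    split_ifs with h1 h2
    · subst h1
      have h3 : (m J : ℕ) / K J < L := by
        rw [Nat.div_lt_iff_lt_mul (hK J), mul_comm]
        exact (m J).2.trans_le hJ
      have h4 : ((m A : ℕ) + 1) * L ≤ K' A * L := Nat.mul_le_mul_right _ (m A).2
      rw [add_mul, one_mul] at h4
      lia
    · subst h2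
      exact Nat.mod_lt _ (hK _)
    · exact (m A).2.trans_le (hle A h1 h2)
  refine c.exists_transfer hK hK' (fun m A => ⟨_, hbound m A⟩)
    (fun w A => if h : (if A = I then w I / L
      else if A = J then w J + K J * (w I % L) else (w A : ℕ)) < K' A then ⟨_, h⟩
      else ⟨0, hK' A⟩) (fun m => ?_) (fun i m m' h => ?_)
  · have h3 : (m J : ℕ) / K J < L := by
      rw [Nat.div_lt_iff_lt_mul (hK J), mul_comm]
      exact (m J).2.trans_le hJ
    funext A
    have key : (if A = I then (m I * L + m J / K J) / L
        else if A = J then m J % K J + K J * ((m I * L + m J / K J) % L) else (m A : ℕ)) = m A := by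
      split_ifs with h1 h2
      · subst h1
        rw [mul_comm, Nat.mul_add_div hL, Nat.div_eq_of_lt h3, add_zero]
      · subst h2
        rw [mul_comm _ L, Nat.mul_add_mod, Nat.mod_eq_of_lt h3, Nat.mod_add_div]
      · rfl
    apply Fin.ext
    by_cases h1 : A = I
    · subst h1
      simp only [if_true] at key
      simp [key]
    · by_cases h2 : A = J
      · subst h2
        simp [h1, Nat.mod_eq_of_lt h3, Nat.mod_add_div]
      · simp [h1, h2]
  · funext ⟨A, hA⟩
    have hall (B : Fin 7) (hB : i ∈ users B) : m B = m' B := congrFun h ⟨B, hB⟩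
    simp only [localPart]
    apply Fin.ext
    show (if A = I then m I * L + m J / K J else if A = J then m J % K J else (m A : ℕ)) =
      if A = I then m' I * L + m' J / K J else if A = J then m' J % K J else (m' A : ℕ)
    split_ifs with h1 h2
    · subst h1
      rw [hall A hA, hall J (hIJ hA)]
    · subst h2
      rw [hall A hA]
    · rw [hall A hA]

/-- Rate `t` of channel message `I` carries message `J`, up to an arbitrarily small loss `η`. -/
theorem Achievable.move {ch : MAC} {R : Fin 7 → ℝ} (h : Achievable ch R) {I J : Fin 7}
    (hIJ : users I ⊆ users J) (hne : I ≠ J) {t η : ℝ} (ht : 0 ≤ t) (htR : t ≤ R I) (hη : 0 < η)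
    (hηt : η ≤ t) : Achievable ch (R - Pi.single I t + Pi.single J (t - η)) := by
  have hR := h.1
  set R' := R - Pi.single I t + Pi.single J (t - η) with hR'def
  have hR'I : R' I = R I - t := by simp [R', hne]
  have hR'J : R' J = R J + t - η := by simp [R', hne.symm]; ring
  have hR'A (A : Fin 7) (h1 : A ≠ I) (h2 : A ≠ J) : R' A = R A := by simp [R', h1, h2]
  have hR' : 0 ≤ R' := fun A => by
    by_cases h1 : A = I
    · rw [h1, hR'I]; simpa using htR
    · by_cases h2 : A = J
      · rw [h2, hR'J]
        have := hR J
        simp only [Pi.zero_apply] at this ⊢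
        linarith
      · rw [hR'A A h1 h2]; exact hR A
  refine h.transfer hR' ?_
  filter_upwards [eventually_ge_atTop ⌈2 / η⌉₊] with n hn c
  -- The two floors in the bound for `J` lose a factor of at most 2 each; `2 ^ (n * η) ≥ 4` pays for
  -- both.
  have hnη : 2 ≤ n * η := by
    rw [← div_le_iff₀ hη]
    exact (Nat.le_ceil _).trans (by exact_mod_cast hn)
  have hn0 : (0 : ℝ) ≤ n := Nat.cast_nonneg n
  refine c.exists_transfer_move (numMessages_pos hR n) (numMessages_pos hR' n) hIJ hne
    (L := ⌊(2 : ℝ) ^ (n * t)⌋₊) ?_ ?_ ?_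
  · have half (x : ℝ) (hx : 0 ≤ x) : (2 : ℝ) ^ x / 2 ≤ ⌊(2 : ℝ) ^ x⌋₊ := by
      have h1 := Real.one_le_rpow one_le_two hx
      have h2 := Nat.lt_floor_add_one ((2 : ℝ) ^ x)
      have h3 : (1 : ℝ) ≤ ⌊(2 : ℝ) ^ x⌋₊ := by exact_mod_cast Nat.floor_pos.2 h1
      linarith
    have h1 := half (n * R J) (mul_nonneg hn0 (hR J))
    have h2 := half (n * t) (mul_nonneg hn0 ht)
    have h3 : (2 : ℝ) ^ (n * R' J) ≤ (2 : ℝ) ^ (n * R J) / 2 * ((2 : ℝ) ^ (n * t) / 2) := by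
      calc (2 : ℝ) ^ (n * R' J) ≤ (2 : ℝ) ^ (n * R J + n * t - (2 : ℝ)) :=
            Real.rpow_le_rpow_of_exponent_le one_le_two (by rw [hR'J]; nlinarith)
        _ = _ := by
            rw [Real.rpow_sub zero_lt_two, Real.rpow_add zero_lt_two]
            norm_num
            ring
    have h4 : ((numMessages R' n J : ℕ) : ℝ) ≤
        ((numMessages R n J * ⌊(2 : ℝ) ^ (n * t)⌋₊ : ℕ) : ℝ) := by
      push_cast
      calc ((numMessages R' n J : ℕ) : ℝ) ≤ (2 : ℝ) ^ (n * R' J) := Nat.floor_le (by positivity)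
        _ ≤ _ := h3
        _ ≤ _ := mul_le_mul h1 h2 (by positivity) (by positivity)
    exact_mod_cast h4
  · refine Nat.le_floor ?_
    push_cast
    calc ((numMessages R' n I : ℕ) : ℝ) * (⌊(2 : ℝ) ^ (n * t)⌋₊ : ℝ)
        ≤ (2 : ℝ) ^ (n * R' I) * (2 : ℝ) ^ (n * t) :=
          mul_le_mul (Nat.floor_le (by positivity)) (Nat.floor_le (by positivity)) (by positivity)
            (by positivity)
      _ = (2 : ℝ) ^ (n * R I) := by
          rw [← Real.rpow_add zero_lt_two, hR'I]
          ring_nf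
  · intro A h1 h2
    simp [numMessages, hR'A A h1 h2]

theorem capacityRegion_nonneg {ch : MAC} {R : Fin 7 → ℝ} (h : R ∈ capacityRegion ch) : 0 ≤ R :=
  closure_minimal (fun _ h => h.1) (isClosed_le continuous_const continuous_id) h

theorem capacityRegion_mono {ch : MAC} {R R' : Fin 7 → ℝ} (h : R ∈ capacityRegion ch)
    (hR' : 0 ≤ R') (hle : R' ≤ R) : R' ∈ capacityRegion ch := by
  -- Truncation at `R'` is continuous, preserves achievability and sends `R` to `R'`.
  have := map_mem_closure (f := fun x => x ⊓ R') 
    (continuous_pi fun I => (continuous_apply I).min continuous_const) h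
    (t := {R | Achievable ch R}) fun x hx => hx.mono (le_inf hx.1 hR') inf_le_left
  rwa [inf_eq_right.2 hle] at this

theorem capacityRegion_move {ch : MAC} {R : Fin 7 → ℝ} (h : R ∈ capacityRegion ch) {I J : Fin 7}
    (hIJ : users I ⊆ users J) (hne : I ≠ J) {t : ℝ} (ht : 0 ≤ t) (htR : t ≤ R I) :
    R - Pi.single I t + Pi.single J t ∈ capacityRegion ch := by
  -- Points `x` near `R` may have `x I < t`, so the moved amount is clamped to `min t (x I)`, which
  -- is continuous in `x`.
  have key (x : Fin 7 → ℝ) (hx : Achievable ch x) :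
      x - Pi.single I (min t (x I)) + Pi.single J (min t (x I)) ∈ capacityRegion ch := by
    have hs0 : 0 ≤ min t (x I) := le_min ht (hx.1 I)
    rcases hs0.eq_or_lt with hs | hs
    · rw [← hs]
      have := subset_closure (s := {R | Achievable ch R}) hx
      rwa [Pi.single_zero, Pi.single_zero, sub_zero, add_zero]
    · refine mem_closure_of_tendsto (b := 𝓝[>] (0 : ℝ))
        (f := fun η => x - Pi.single I (min t (x I)) + Pi.single J (min t (x I) - η)) ?_ ?_
      · have : Tendsto (fun η : ℝ =>
            x - Pi.single I (min t (x I)) + Pi.single J (min t (x I) - η)) (𝓝 0)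
            (𝓝 (x - Pi.single I (min t (x I)) + Pi.single J (min t (x I) - 0))) := by
          refine Continuous.tendsto (continuous_const.add ?_) 0
          exact (continuous_single (A := fun _ : Fin 7 => ℝ) J).comp
            (continuous_const.sub continuous_id)
        rw [sub_zero] at this
        exact this.mono_left nhdsWithin_le_nhds
      · filter_upwards [Ioc_mem_nhdsGT hs] with η hη
        exact hx.move hIJ hne hs0 (min_le_right _ _) hη.1 hη.2
  have hcont : Continuous fun x : Fin 7 → ℝ => min t (x I) :=
    continuous_const.min (continuous_apply I)
  have := map_mem_closure
    (f := fun x : Fin 7 → ℝ => x - Pi.single I (min t (x I)) + Pi.single J (min t (x I)))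
    ((continuous_id.sub ((continuous_single (A := fun _ : Fin 7 => ℝ) I).comp hcont)).add
      ((continuous_single (A := fun _ : Fin 7 => ℝ) J).comp hcont)) h (t := capacityRegion ch)
    fun x hx => key x hx
  rwa [min_eq_left htR, capacityRegion, closure_closure] at this

/-- The direct part: the capacity region contains every nonnegative point of the shifted cone. -/
theorem capacityRegion_of_mem_cone {ch : MAC} {R R' : Fin 7 → ℝ} (h : R ∈ capacityRegion ch)
    (hR' : 0 ≤ R') (hc : R' - R ∈ multicastCone) : R' ∈ capacityRegion ch := by
  obtain ⟨a, ha, hsum⟩ := exists_nonneg_combination hc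
  have hR := capacityRegion_nonneg h
  have e (I : Fin 7) := congrFun hsum I
  have e0 := e 0; have e1 := e 1; have e2 := e 2; have e3 := e 3
  have e4 := e 4; have e5 := e 5; have e6 := e 6
  simp [Fin.sum_univ_succ, hcol, Fin.succ] at e0 e1 e2 e3 e4 e5 e6
  have a0 := ha 0; have a1 := ha 1; have a2 := ha 2; have a3 := ha 3; have a4 := ha 4
  have a5 := ha 5; have a6 := ha 6; have a7 := ha 7; have a8 := ha 8; have a9 := ha 9
  have p0 := hR' 0; have p1 := hR' 1; have p2 := hR' 2; have p3 := hR' 3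
  have p4 := hR' 4; have p5 := hR' 5; have p6 := hR' 6
  have r0 := hR 0; have r1 := hR 1; have r2 := hR 2; have r3 := hR 3
  have r4 := hR 4; have r5 := hR 5; have r6 := hR 6
  simp only [Pi.zero_apply] at *
  -- Singletons are emptied before pairs, so an index that starts to give no longer receives; it
  -- only decreases towards its final value in `R'`, which is nonnegative. The waste `a 9` is left
  -- to monotonicity.
  have h0 := capacityRegion_move h (I := 0) (J := 3) (by decide) (by decide) a0 (by linarith)
  have h1 := capacityRegion_move h0 (I := 0) (J := 4) (by decide) (by decide) a1
    (by simp; linarith)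
  have h2 := capacityRegion_move h1 (I := 1) (J := 3) (by decide) (by decide) a2
    (by simp; linarith)
  have h3 := capacityRegion_move h2 (I := 1) (J := 5) (by decide) (by decide) a3
    (by simp; linarith)
  have h4 := capacityRegion_move h3 (I := 2) (J := 4) (by decide) (by decide) a4
    (by simp; linarith)
  have h5 := capacityRegion_move h4 (I := 2) (J := 5) (by decide) (by decide) a5
    (by simp; linarith)
  have h6 := capacityRegion_move h5 (I := 3) (J := 6) (by decide) (by decide) a6
    (by simp; linarith)
  have h7 := capacityRegion_move h6 (I := 4) (J := 6) (by decide) (by decide) a7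
    (by simp; linarith)
  have h8 := capacityRegion_move h7 (I := 5) (J := 6) (by decide) (by decide) a8
    (by simp; linarith)
  refine capacityRegion_mono h8 hR' fun I => ?_
  fin_cases I <;> simp <;> linarith

/-! ### The link channels -/

/-- A transmitter that knows message `J`. -/
def firstUser : Fin 7 → Fin 3 := ![0, 1, 2, 0, 0, 1, 0]

theorem firstUser_mem (J : Fin 7) : firstUser J ∈ users J := by
  revert J; decide

/-- The noiseless output of seven parallel links: link `J` delivers its symbol if all transmitters
in `users J` agree on it. -/
def linkOutput {k : Fin 7 → ℕ} (x : Fin 3 → ∀ J, Fin (k J)) (J : Fin 7) : Option (Fin (k J)) :=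
  if ∀ i ∈ users J, x i J = x (firstUser J) J then some (x (firstUser J) J) else none

/-- The Bernoulli weight of "not erased". -/
def bern (δ : ℝ) (b : Bool) : ℝ := if b then δ else 1 - δ

/-- Erasure unless `b`. -/
def letter {Z : Type} (b : Bool) (z : Z) : Option Z := if b then some z else none

theorem sum_bern (δ : ℝ) : ∑ b, bern δ b = 1 := by simp [bern]

theorem bern_nonneg {δ : ℝ} (h0 : 0 ≤ δ) (h1 : δ ≤ 1) (b : Bool) : 0 ≤ bern δ b := by
  cases b <;> simp [bern, h0, h1]

theorem letter_inj {Z : Type} {b b' : Bool} {z z' : Z} (h : letter b z = letter b' z') :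
    b = b' ∧ (b = true → z = z') := by
  cases b <;> cases b' <;> simp_all [letter]

/-- Seven parallel links with alphabets of sizes `k J`, all erased simultaneously with
probability `1 - δ`. -/
def linkChannel (k : Fin 7 → ℕ) (δ : ℝ) (h0 : 0 ≤ δ) (h1 : δ ≤ 1) : MAC where
  X _ := ∀ J, Fin (k J)
  Y := Option (∀ J, Option (Fin (k J)))
  p x y := ∑ b, bern δ b * if y = letter b (linkOutput x) then 1 else 0
  p_nonneg x y := Finset.sum_nonneg fun b _ =>
    mul_nonneg (bern_nonneg h0 h1 b) (by split_ifs <;> simp)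
  p_sum x := by
    rw [Finset.sum_comm]
    simp only [← Finset.mul_sum, Finset.sum_ite_eq', Finset.mem_univ, if_true,
      mul_one, sum_bern]

/-- Expanding the product over time exhibits the memoryless law as a mixture over erasure patterns,
with a deterministic output for each. -/
theorem sum_mul_prod_bern {Z : Type} [Fintype Z] [DecidableEq Z] {n : ℕ} (δ : ℝ) (z : Fin n → Z)
    (F : (Fin n → Option Z) → ℝ) :
    ∑ y, F y * ∏ t, ∑ b, bern δ b * (if y t = letter b (z t) then 1 else 0) =
      ∑ b : Fin n → Bool, (∏ t, bern δ (b t)) * F fun t => letter (b t) (z t) := by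
  have h (y : Fin n → Option Z) : ∏ t, ∑ b, bern δ b * (if y t = letter b (z t) then 1 else 0) =
      ∑ b : Fin n → Bool, (∏ t, bern δ (b t)) *
        if y = fun t => letter (b t) (z t) then 1 else 0 := by
    rw [Finset.prod_univ_sum, Fintype.piFinset_univ]
    refine Finset.sum_congr rfl fun b _ => ?_
    rw [Finset.prod_mul_distrib, Finset.prod_ite_zero]
    simp [funext_iff]
  simp only [h, Finset.mul_sum]
  rw [Finset.sum_comm]
  refine Finset.sum_congr rfl fun b _ => ?_
  simp [mul_comm]

section

variable {k : Fin 7 → ℕ} {δ : ℝ} {h0 : 0 ≤ δ} {h1 : δ ≤ 1} {K : Fin 7 → ℕ} {n : ℕ}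

/-- The noiseless link outputs when `w` is sent. -/
def Code.noiseless (c : Code (linkChannel k δ h0 h1) K n) (w : Messages K) (t : Fin n) :
    ∀ J, Option (Fin (k J)) :=
  linkOutput fun i => c.enc i (localPart w i) t

/-- The decoder, as a function of the possibly erased link outputs. -/
def Code.linkDec (c : Code (linkChannel k δ h0 h1) K n) :
    (Fin n → Option (∀ J, Option (Fin (k J)))) → Messages K :=
  c.dec

open Classical in
theorem Code.errorProb_link (c : Code (linkChannel k δ h0 h1) K n) :
    c.errorProb = (Fintype.card (Messages K) : ℝ)⁻¹ * ∑ w, ∑ b : Fin n → Bool,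
      (∏ t, bern δ (b t)) *
        if c.linkDec (fun t => letter (b t) (c.noiseless w t)) ≠ w then 1 else 0 := by
  unfold Code.errorProb
  congr 1
  refine Finset.sum_congr rfl fun w _ => ?_
  have := sum_mul_prod_bern δ (c.noiseless w) fun y => if c.linkDec y ≠ w then (1 : ℝ) else 0
  rw [← this]
  refine Finset.sum_congr rfl fun y _ => ?_
  rw [ite_mul, one_mul, zero_mul]
  congr! with _ t

end

/-! ### Random coding for the link channels -/

/-- Random coding for one link: a codebook of `K` words over `Fin k` such that, after erasures, a
random word is confused with another one with small probability. -/
theorem exists_codebook (K k n : ℕ) (hK : 0 < K) (hk : 0 < k) {δ ρ : ℝ} (h0 : 0 ≤ δ) (h1 : δ ≤ 1)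
    (hρ0 : 0 < ρ) (hρ1 : ρ ≤ 1) :
    ∃ C : Fin n → Fin K → Fin k,
      (K : ℝ)⁻¹ * ∑ a₀, ∑ b : Fin n → Bool, (∏ t, bern δ (b t)) *
        (if ∃ a, a ≠ a₀ ∧ ∀ t, b t = true → C t a = C t a₀ then 1 else 0) ≤
      ((K : ℝ) - 1) ^ ρ * (1 - δ + δ * (k : ℝ) ^ (-ρ)) ^ n := by
  have : NeZero k := ⟨hk.ne'⟩
  have hkR : (0 : ℝ) < k := by exact_mod_cast hk
  have hKR : (0 : ℝ) < K := by exact_mod_cast hK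
  have hK1 : (0 : ℝ) ≤ K - 1 := by
    have : (1 : ℝ) ≤ K := by exact_mod_cast hK
    linarith
  have hβ (b : Fin n → Bool) : 0 ≤ ∏ t, bern δ (b t) :=
    Finset.prod_nonneg fun t _ => bern_nonneg h0 h1 _
  set N : ℝ := ((Fintype.card (Fin n → Fin K → Fin k) : ℕ) : ℝ) with hN
  have hNpos : 0 < N := by
    rw [hN]; exact_mod_cast Fintype.card_pos
  -- a single position
  have hpos (a a₀ : Fin K) (ha : a ≠ a₀) :
      ∑ φ : Fin K → Fin k, (if φ a = φ a₀ then (1 : ℝ) else 0) =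
        (k : ℝ)⁻¹ * Fintype.card (Fin K → Fin k) := by
    -- Translating the value at `a` by `s` permutes the maps `φ`, so the `k` translates of the event
    -- are equally frequent, and they partition all maps.
    have e1 : ∑ s : Fin k, ∑ φ : Fin K → Fin k, (if φ a + s = φ a₀ then (1 : ℝ) else 0) =
        Fintype.card (Fin K → Fin k) := by
      rw [Finset.sum_comm]
      have (φ : Fin K → Fin k) (s : Fin k) : (φ a + s = φ a₀) ↔ s = φ a₀ - φ a := by
        rw [eq_sub_iff_add_eq, add_comm]
      simp [this]
    have e2 (s : Fin k) : ∑ φ : Fin K → Fin k, (if φ a + s = φ a₀ then (1 : ℝ) else 0) =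
        ∑ φ : Fin K → Fin k, (if φ a = φ a₀ then (1 : ℝ) else 0) := by
      rw [← Equiv.sum_comp (Equiv.addRight (Pi.single a s))
        fun φ : Fin K → Fin k => if φ a = φ a₀ then (1 : ℝ) else 0]
      refine Finset.sum_congr rfl fun φ _ => ?_
      simp [ha.symm]
    simp only [e2, Finset.sum_const, Finset.card_univ, Fintype.card_fin, nsmul_eq_mul] at e1
    rw [← e1, inv_mul_cancel_left₀ hkR.ne']
  -- a fixed pair of words and a fixed erasure pattern
  have hpair (a a₀ : Fin K) (ha : a ≠ a₀) (b : Fin n → Bool) :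
      ∑ C : Fin n → Fin K → Fin k, (if ∀ t, b t = true → C t a = C t a₀ then (1 : ℝ) else 0) =
        N * ∏ t, if b t then (k : ℝ)⁻¹ else 1 := by
    have e (C : Fin n → Fin K → Fin k) :
        (if ∀ t, b t = true → C t a = C t a₀ then (1 : ℝ) else 0) =
          ∏ t, if b t = true → C t a = C t a₀ then (1 : ℝ) else 0 := by
      rw [Finset.prod_ite_zero]
      simp
    simp only [e]
    have := Finset.prod_univ_sum (fun _ : Fin n => (Finset.univ : Finset (Fin K → Fin k)))
      fun t φ => if b t = true → φ a = φ a₀ then (1 : ℝ) else 0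
    rw [Fintype.piFinset_univ] at this
    rw [← this, hN, Fintype.card_pi, Nat.cast_prod, ← Finset.prod_mul_distrib]
    refine Finset.prod_congr rfl fun t _ => ?_
    cases hbt : b t
    · simp
    · simp only [forall_const, if_true]
      rw [hpos a a₀ ha, mul_comm]
  have hbound (a₀ : Fin K) (b : Fin n → Bool) :
      ∑ C : Fin n → Fin K → Fin k,
        (if ∃ a, a ≠ a₀ ∧ ∀ t, b t = true → C t a = C t a₀ then (1 : ℝ) else 0) ≤
        N * (((K : ℝ) - 1) ^ ρ * ∏ t, if b t then (k : ℝ) ^ (-ρ) else 1) := by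
    set z : ℝ := ∏ t, if b t then (k : ℝ)⁻¹ else 1 with hz
    have hz0 : 0 ≤ z := Finset.prod_nonneg fun t _ => by split_ifs <;> positivity
    have hz2 : ((K : ℝ) - 1) ^ ρ * (∏ t, if b t then (k : ℝ) ^ (-ρ) else 1) =
        (((K : ℝ) - 1) * z) ^ ρ := by
      rw [Real.mul_rpow hK1 hz0, hz, ← Real.finsetProd_rpow _ _
        fun t _ => by split_ifs <;> positivity]
      congr 1
      refine Finset.prod_congr rfl fun t _ => ?_
      split_ifs
      · rw [Real.inv_rpow hkR.le, Real.rpow_neg hkR.le]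
      · rw [Real.one_rpow]
    rw [hz2]
    have hle1 : ∑ C : Fin n → Fin K → Fin k,
        (if ∃ a, a ≠ a₀ ∧ ∀ t, b t = true → C t a = C t a₀ then (1 : ℝ) else 0) ≤ N := by
      calc _ ≤ ∑ C : Fin n → Fin K → Fin k, (1 : ℝ) :=
            Finset.sum_le_sum fun C _ => by split_ifs <;> simp
        _ = N := by simp [hN]
    have hle2 : ∑ C : Fin n → Fin K → Fin k,
        (if ∃ a, a ≠ a₀ ∧ ∀ t, b t = true → C t a = C t a₀ then (1 : ℝ) else 0) ≤
        N * (((K : ℝ) - 1) * z) := by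
      calc _ ≤ ∑ C : Fin n → Fin K → Fin k, ∑ a ∈ Finset.univ.erase a₀,
              (if ∀ t, b t = true → C t a = C t a₀ then (1 : ℝ) else 0) := by
            refine Finset.sum_le_sum fun C _ => ?_
            split_ifs with h
            · obtain ⟨a, ha, hC⟩ := h
              have := Finset.single_le_sum (s := Finset.univ.erase a₀)
                (f := fun a => if ∀ t, b t = true → C t a = C t a₀ then (1 : ℝ) else 0)
                (fun a _ => by split_ifs <;> simp) (Finset.mem_erase.2 ⟨ha, Finset.mem_univ a⟩)
              simpa only [if_pos hC] using this
            · exact Finset.sum_nonneg fun a _ => by split_ifs <;> simp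
        _ = N * (((K : ℝ) - 1) * z) := by
            rw [Finset.sum_comm, Finset.sum_congr rfl fun a ha =>
              hpair a a₀ (Finset.mem_erase.1 ha).1 b, Finset.sum_const,
              Finset.card_erase_of_mem (Finset.mem_univ _), Finset.card_univ, Fintype.card_fin,
              nsmul_eq_mul, Nat.cast_sub hK, Nat.cast_one]
            ring
    -- Gallager's interpolation between the trivial bound and the union bound: `min 1 x ≤ x ^ ρ`.
    rcases le_total 1 (((K : ℝ) - 1) * z) with h | h
    · refine hle1.trans (le_mul_of_one_le_right hNpos.le (Real.one_le_rpow h hρ0.le))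
    · refine hle2.trans (mul_le_mul_of_nonneg_left ?_ hNpos.le)
      simpa using Real.rpow_le_rpow_of_exponent_ge' (mul_nonneg hK1 hz0) h hρ0.le hρ1
  have hsum : ∑ C : Fin n → Fin K → Fin k, ((K : ℝ)⁻¹ * ∑ a₀, ∑ b : Fin n → Bool,
      (∏ t, bern δ (b t)) *
        (if ∃ a, a ≠ a₀ ∧ ∀ t, b t = true → C t a = C t a₀ then 1 else 0)) ≤
      ∑ C : Fin n → Fin K → Fin k, ((K : ℝ) - 1) ^ ρ * (1 - δ + δ * (k : ℝ) ^ (-ρ)) ^ n := by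
    rw [← Finset.mul_sum, Finset.sum_comm]
    have hprod : ∑ b : Fin n → Bool, (∏ t, bern δ (b t)) *
        ∏ t, (if b t then (k : ℝ) ^ (-ρ) else 1) = (1 - δ + δ * (k : ℝ) ^ (-ρ)) ^ n := by
      have := Finset.prod_univ_sum (fun _ : Fin n => (Finset.univ : Finset Bool))
        fun _ b => bern δ b * if b then (k : ℝ) ^ (-ρ) else 1
      rw [Fintype.piFinset_univ] at this
      simp only [← Finset.prod_mul_distrib]
      rw [← this]
      simp [bern, add_comm]
    calc (K : ℝ)⁻¹ * ∑ a₀, ∑ C : Fin n → Fin K → Fin k, ∑ b : Fin n → Bool,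
          (∏ t, bern δ (b t)) *
            (if ∃ a, a ≠ a₀ ∧ ∀ t, b t = true → C t a = C t a₀ then 1 else 0)
        ≤ (K : ℝ)⁻¹ * ∑ a₀ : Fin K, N * (((K : ℝ) - 1) ^ ρ *
            (1 - δ + δ * (k : ℝ) ^ (-ρ)) ^ n) := by
          refine mul_le_mul_of_nonneg_left (Finset.sum_le_sum fun a₀ _ => ?_) (by positivity)
          rw [Finset.sum_comm, ← hprod, Finset.mul_sum, Finset.mul_sum]
          refine Finset.sum_le_sum fun b _ => ?_
          rw [← Finset.mul_sum]
          refine (mul_le_mul_of_nonneg_left (hbound a₀ b) (hβ b)).trans_eq ?_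
          ring
      _ = _ := by
          rw [Finset.sum_const, Finset.sum_const, Finset.card_univ, Finset.card_univ,
            Fintype.card_fin, nsmul_eq_mul, nsmul_eq_mul, inv_mul_cancel_left₀ hKR.ne']
  have : Nonempty (Fin n → Fin K → Fin k) := ⟨fun _ _ => 0⟩
  obtain ⟨C, -, hC⟩ := Finset.exists_le_of_sum_le Finset.univ_nonempty hsum
  exact ⟨C, hC⟩

/-- The Gallager exponent of an erasure link is positive below capacity. -/
theorem exists_exponent {k : ℕ} (hk : 0 < k) {δ r : ℝ} (h0 : 0 < δ) (hr : 0 < r)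
    (h : r * Real.log 2 < δ * Real.log k) :
    ∃ ρ, 0 < ρ ∧ ρ ≤ 1 ∧ (2 : ℝ) ^ (ρ * r) * (1 - δ + δ * (k : ℝ) ^ (-ρ)) < 1 := by
  have hkR : (0 : ℝ) < k := by exact_mod_cast hk
  set u := r * Real.log 2 with hu
  set v := Real.log k with hv
  have hu0 : 0 < u := mul_pos hr (Real.log_pos one_lt_two)
  have hv0 : 0 < v := pos_of_mul_pos_right (hu0.trans h) h0.le
  -- With `exp (-(ρ * v)) ≤ 1 / (1 + ρ * v)`, the claim reduces to `u * (1 + ρ * v) < δ * v`, true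
  -- for small `ρ`.
  obtain ⟨c, hc0, hc⟩ := exists_pos_mul_lt (sub_pos.2 h) (u * v)
  refine ⟨min 1 c, lt_min one_pos hc0, min_le_left _ _, ?_⟩
  set ρ := min 1 c
  have hρ0 : 0 < ρ := lt_min one_pos hc0
  have hρc : u * v * ρ < δ * v - u :=
    (mul_le_mul_of_nonneg_left (min_le_right _ _) (by positivity)).trans_lt hc
  have e1 : (2 : ℝ) ^ (ρ * r) = Real.exp (ρ * u) := by
    rw [Real.rpow_def_of_pos zero_lt_two, hu]; ring_nf
  have e2 : (k : ℝ) ^ (-ρ) = Real.exp (-(ρ * v)) := by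
    rw [Real.rpow_def_of_pos hkR, hv]; ring_nf
  have e3 : Real.exp (-(ρ * v)) ≤ 1 / (1 + ρ * v) := by
    rw [Real.exp_neg, ← one_div]
    refine one_div_le_one_div_of_le (by positivity) ?_
    linarith [Real.add_one_le_exp (ρ * v)]
  have e4 : ρ * u < δ * (1 - Real.exp (-(ρ * v))) := by
    have h1 : ρ * u < δ * (1 - 1 / (1 + ρ * v)) := by
      have : 1 - 1 / (1 + ρ * v) = ρ * v / (1 + ρ * v) := by
        field_simp; ring
      rw [this, ← mul_div_assoc, lt_div_iff₀ (by positivity)]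
      nlinarith
    refine h1.trans_le (mul_le_mul_of_nonneg_left ?_ h0.le)
    linarith
  rw [e1, e2]
  have e5 : 1 - δ + δ * Real.exp (-(ρ * v)) ≤ Real.exp (-(δ * (1 - Real.exp (-(ρ * v))))) := by
    have := Real.add_one_le_exp (-(δ * (1 - Real.exp (-(ρ * v)))))
    linarith
  calc _ ≤ Real.exp (ρ * u) * Real.exp (-(δ * (1 - Real.exp (-(ρ * v))))) :=
        mul_le_mul_of_nonneg_left e5 (Real.exp_pos _).le
    _ < 1 := by
        rw [← Real.exp_add, Real.exp_lt_one_iff]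
        linarith

/-- Every message is sent over its own link, with its own codebook. -/
theorem exists_code_of_codebooks {k : Fin 7 → ℕ} {δ : ℝ} (h0 : 0 ≤ δ) (h1 : δ ≤ 1)
    (hk : ∀ J, 0 < k J) {K : Fin 7 → ℕ} (hK : ∀ J, 0 < K J) {n : ℕ}
    (C : ∀ J, Fin n → Fin (K J) → Fin (k J)) :
    ∃ c : Code (linkChannel k δ h0 h1) K n, c.errorProb ≤
      ∑ J, (K J : ℝ)⁻¹ * ∑ a₀, ∑ b : Fin n → Bool, (∏ t, bern δ (b t)) *
        (if ∃ a, a ≠ a₀ ∧ ∀ t, b t = true → C J t a = C J t a₀ then 1 else 0) := by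
  classical
  let out (w : Messages K) (t : Fin n) : ∀ J, Option (Fin (k J)) := fun J => some (C J t (w J))
  let enc (i : Fin 3) (l : LocalMessages K i) (t : Fin n) (J : Fin 7) : Fin (k J) :=
    if h : i ∈ users J then C J t (l ⟨J, h⟩) else ⟨0, hk J⟩
  -- Any message vector consistent with the unerased symbols is accepted; an error then forces a
  -- confusion in at least one codebook.
  let dec (y : Fin n → Option (∀ J, Option (Fin (k J)))) : Messages K :=
    if h : ∃ w, ∃ b : Fin n → Bool, y = fun t => letter (b t) (out w t) then h.choose
      else fun J => ⟨0, hK J⟩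
  let c : Code (linkChannel k δ h0 h1) K n := ⟨enc, dec⟩
  have hout (w : Messages K) : c.noiseless w = out w := by
    funext t J
    have (i : Fin 3) (hi : i ∈ users J) : enc i (localPart w i) t J = C J t (w J) := by
      simp [enc, hi, localPart]
    show linkOutput (fun i => enc i (localPart w i) t) J = _
    unfold linkOutput
    simp only
    rw [if_pos fun i hi => by rw [this i hi, this _ (firstUser_mem J)], this _ (firstUser_mem J)]
  refine ⟨c, ?_⟩
  have hβ (b : Fin n → Bool) : 0 ≤ ∏ t, bern δ (b t) :=
    Finset.prod_nonneg fun t _ => bern_nonneg h0 h1 _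
  let G (J : Fin 7) (a₀ : Fin (K J)) : ℝ := ∑ b : Fin n → Bool, (∏ t, bern δ (b t)) *
        (if ∃ a, a ≠ a₀ ∧ ∀ t, b t = true → C J t a = C J t a₀ then 1 else 0)
  have hw (w : Messages K) : ∑ b : Fin n → Bool, (∏ t, bern δ (b t)) *
      (if c.linkDec (fun t => letter (b t) (c.noiseless w t)) ≠ w then 1 else 0) ≤
      ∑ J, G J (w J) := by
    rw [hout, show c.linkDec = dec from rfl]
    simp only [G]
    rw [Finset.sum_comm]
    refine Finset.sum_le_sum fun b _ => ?_
    rw [← Finset.mul_sum]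
    refine mul_le_mul_of_nonneg_left ?_ (hβ b)
    split_ifs with hdec
    · have hex : ∃ w', ∃ b' : Fin n → Bool,
          (fun t => letter (b t) (out w t)) = fun t => letter (b' t) (out w' t) := ⟨w, b, rfl⟩
      have hd : dec (fun t => letter (b t) (out w t)) = hex.choose := dif_pos hex
      rw [hd] at hdec
      obtain ⟨b', hb'⟩ := hex.choose_spec
      obtain ⟨J, hJ⟩ := Function.ne_iff.1 hdec
      have hconf : ∃ a, a ≠ w J ∧ ∀ t, b t = true → C J t a = C J t (w J) := by
        refine ⟨_, hJ, fun t ht => ?_⟩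
        have := congrFun ((letter_inj (congrFun hb' t)).2 ht) J
        simpa [out] using this.symm
      have := Finset.single_le_sum (s := Finset.univ) (f := fun J =>
        if ∃ a, a ≠ w J ∧ ∀ t, b t = true → C J t a = C J t (w J) then (1 : ℝ) else 0)
        (fun a _ => by split_ifs <;> simp) (Finset.mem_univ J)
      simpa only [if_pos hconf] using this
    · exact Finset.sum_nonneg fun a _ => by split_ifs <;> simp
  have hne (J : Fin 7) : Nonempty (Fin (K J)) := ⟨⟨0, hK J⟩⟩
  have hmarg (J : Fin 7) : (Fintype.card (Messages K) : ℝ)⁻¹ * ∑ w : Messages K, G J (w J) =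
      (K J : ℝ)⁻¹ * ∑ a₀, G J a₀ := by
    have hKJ : (0 : ℝ) < K J := by exact_mod_cast hK J
    have e := Fintype.sum_equiv (Equiv.piSplitAt J fun I => Fin (K I))
      (fun w => G J (w J)) (fun p => G J p.1) fun w => rfl
    have hcard := Fintype.card_congr (Equiv.piSplitAt J fun I => Fin (K I))
    have hrest : (0 : ℝ) < Fintype.card (∀ I : {I // I ≠ J}, Fin (K I)) := by
      exact_mod_cast Fintype.card_pos
    rw [Fintype.card_prod, Fintype.card_fin] at hcard
    rw [e, hcard, Fintype.sum_prod_type]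
    simp only [Finset.sum_const, Finset.card_univ, nsmul_eq_mul, ← Finset.mul_sum]
    push_cast
    field_simp
  calc c.errorProb ≤ (Fintype.card (Messages K) : ℝ)⁻¹ * ∑ w : Messages K, ∑ J, G J (w J) := by
        rw [Code.errorProb_link]
        refine mul_le_mul_of_nonneg_left (Finset.sum_le_sum fun w _ => ?_) (by positivity)
        convert hw w
    _ = ∑ J, (K J : ℝ)⁻¹ * ∑ a₀, G J a₀ := by
        rw [Finset.sum_comm, Finset.mul_sum]
        exact Finset.sum_congr rfl fun J _ => hmarg J

theorem achievable_linkChannel {k : Fin 7 → ℕ} {δ : ℝ} (h0 : 0 < δ) (h1 : δ ≤ 1)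
    (hk : ∀ J, 0 < k J) {R : Fin 7 → ℝ} (hR : 0 ≤ R)
    (h : ∀ J, R J = 0 ∨ R J * Real.log 2 < δ * Real.log (k J)) :
    Achievable (linkChannel k δ h0.le h1) R := by
  have hexp (J : Fin 7) : ∃ ρ, 0 < ρ ∧ ρ ≤ 1 ∧ (R J = 0 ∨
      (2 : ℝ) ^ (ρ * R J) * (1 - δ + δ * (k J : ℝ) ^ (-ρ)) < 1) := by
    rcases h J with h | h
    · exact ⟨1, one_pos, le_rfl, Or.inl h⟩
    · rcases (hR J).eq_or_lt with h' | h'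
      · exact ⟨1, one_pos, le_rfl, Or.inl h'.symm⟩
      · obtain ⟨ρ, a, b, c⟩ := exists_exponent (hk J) h0 h' h
        exact ⟨ρ, a, b, Or.inr c⟩
  choose ρ hρ0 hρ1 hρ using hexp
  have hcode (n : ℕ) : ∃ c : Code (linkChannel k δ h0.le h1) (numMessages R n) n, c.errorProb ≤
      ∑ J, ((numMessages R n J : ℝ) - 1) ^ ρ J * (1 - δ + δ * (k J : ℝ) ^ (-ρ J)) ^ n := by
    choose C hC using fun J => exists_codebook (numMessages R n J) (k J) n
      (numMessages_pos hR n J) (hk J) h0.le h1 (hρ0 J) (hρ1 J)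
    obtain ⟨c, hc⟩ := exists_code_of_codebooks h0.le h1 hk (numMessages_pos hR n) C
    exact ⟨c, hc.trans (Finset.sum_le_sum fun J _ => hC J)⟩
  choose c hc using hcode
  refine ⟨hR, c, squeeze_zero (fun n => (c n).errorProb_nonneg) hc ?_⟩
  rw [← Finset.sum_const_zero (s := (Finset.univ : Finset (Fin 7))) (M := ℝ)]
  refine tendsto_finsetSum _ fun J _ => ?_
  have hB : 0 ≤ 1 - δ + δ * (k J : ℝ) ^ (-ρ J) := by
    have : 0 ≤ δ * (k J : ℝ) ^ (-ρ J) := by positivity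
    linarith
  rcases hρ J with h | h
  -- At rate zero there is one message, and the factor `K - 1` (not `K`) kills the term even if the
  -- alphabet is trivial.
  · have (n : ℕ) : ((numMessages R n J : ℝ) - 1) = 0 := by simp [numMessages, h]
    simp [this, Real.zero_rpow (hρ0 J).ne']
  · refine squeeze_zero (g := fun n : ℕ =>
      ((2 : ℝ) ^ (ρ J * R J) * (1 - δ + δ * (k J : ℝ) ^ (-ρ J))) ^ n) (fun n => ?_) (fun n => ?_)
      (tendsto_pow_atTop_nhds_zero_of_lt_one (by positivity) h)
    · have : (1 : ℝ) ≤ numMessages R n J := by exact_mod_cast numMessages_pos hR n J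
      exact mul_nonneg (Real.rpow_nonneg (by linarith) _) (by positivity)
    · rw [mul_pow]
      refine mul_le_mul_of_nonneg_right ?_ (by positivity)
      have h1 : (1 : ℝ) ≤ numMessages R n J := by exact_mod_cast numMessages_pos hR n J
      have h2 : (numMessages R n J : ℝ) ≤ (2 : ℝ) ^ (n * R J) := Nat.floor_le (by positivity)
      calc ((numMessages R n J : ℝ) - 1) ^ ρ J ≤ ((2 : ℝ) ^ (n * R J)) ^ ρ J :=
            Real.rpow_le_rpow (by linarith) (by linarith) (hρ0 J).le
        _ = _ := by
            rw [← Real.rpow_mul zero_le_two, ← Real.rpow_mul_natCast zero_le_two]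
            ring_nf

/-! ### Converse for the link channels -/

theorem sum_prod_bern (δ : ℝ) (n : ℕ) : ∑ b : Fin n → Bool, ∏ t, bern δ (b t) = 1 := by
  have := Finset.prod_univ_sum (fun _ : Fin n => (Finset.univ : Finset Bool)) fun _ b => bern δ b
  rw [Fintype.piFinset_univ] at this
  rw [← this]
  simp only [sum_bern, Finset.prod_const_one]

theorem sum_prod_bern_mul (δ : ℝ) {n : ℕ} (t : Fin n) :
    ∑ b : Fin n → Bool, (∏ s, bern δ (b s)) * (if b t then 1 else 0) = δ := by
  have := Finset.prod_univ_sum (fun _ : Fin n => (Finset.univ : Finset Bool))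
    fun s b => bern δ b * if s = t then (if b then 1 else 0) else 1
  rw [Fintype.piFinset_univ] at this
  have e (b : Fin n → Bool) : (∏ s, bern δ (b s)) * (if b t then (1 : ℝ) else 0) =
      ∏ s, bern δ (b s) * if s = t then (if b s then 1 else 0) else 1 := by
    rw [Finset.prod_mul_distrib, Finset.prod_ite_eq' Finset.univ t]
    simp
  simp only [e]
  rw [← this]
  have e2 (s : Fin n) : ∑ b, bern δ b * (if s = t then (if b = true then (1 : ℝ) else 0) else 1) =
      if s = t then δ else 1 := by
    split_ifs <;> simp [bern]
  simp only [e2]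
  rw [Finset.prod_ite_eq' Finset.univ t]
  simp

section

variable {V U Z : Type} [Fintype V] [Fintype U] [Fintype Z] {n : ℕ}

open Classical in
/-- For a fixed erasure pattern, correctly decoded words have disjoint outputs, so their reference
probabilities sum to at most one. -/
theorem sum_correct_le (D : U → Fin n → Z) (dec : (Fin n → Option Z) → U)
    (q : Fin n → Z → ℝ) (hq0 : ∀ t z, 0 ≤ q t z) (hq1 : ∀ t, ∑ z, q t z ≤ 1)
    (b : Fin n → Bool) :
    ∑ u, (if dec (fun t => letter (b t) (D u t)) = u then 1 else 0) *
      ∏ t, (if b t then q t (D u t) else 1) ≤ 1 := by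
  -- A subprobability on outputs with erasure pattern exactly `b`: unerased positions are
  -- independent with weights `q t`.
  let Q (y : Fin n → Option Z) : ℝ :=
    ∏ t, (y t).elim (if b t then 0 else 1) fun z => if b t then q t z else 0
  have hQ0 (y) : 0 ≤ Q y := Finset.prod_nonneg fun t _ => by
    cases y t <;> simp only [Option.elim] <;> split_ifs <;> simp [hq0]
  have hQ (u : U) : Q (fun t => letter (b t) (D u t)) = ∏ t, if b t then q t (D u t) else 1 := by
    refine Finset.prod_congr rfl fun t _ => ?_
    cases hb : b t <;> simp [letter, hb]
  have hQ1 : ∑ y, Q y ≤ 1 := by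
    have := Finset.prod_univ_sum (fun _ : Fin n => (Finset.univ : Finset (Option Z)))
      fun t (o : Option Z) => o.elim (if b t then 0 else 1) fun z => if b t then q t z else 0
    rw [Fintype.piFinset_univ] at this
    rw [← this]
    refine Finset.prod_le_one (fun t _ => Finset.sum_nonneg fun o _ => ?_) fun t _ => ?_
    · cases o <;> simp only [Option.elim] <;> split_ifs <;> simp [hq0]
    · rw [Fintype.sum_option]
      cases hb : b t <;> simp [hq1]
  calc _ = ∑ u, ∑ y, if y = (fun t => letter (b t) (D u t)) ∧ dec y = u then Q y else 0 := by
        refine Finset.sum_congr rfl fun u _ => ?_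
        rw [← hQ]
        simp only [ite_and, Finset.sum_ite_eq', Finset.mem_univ, if_true, ite_mul, one_mul, zero_mul]
    _ = ∑ y, ∑ u, if y = (fun t => letter (b t) (D u t)) ∧ dec y = u then Q y else 0 :=
        Finset.sum_comm
    _ ≤ ∑ y, ∑ u, if dec y = u then Q y else 0 := by
        refine Finset.sum_le_sum fun y _ => Finset.sum_le_sum fun u _ => ?_
        split_ifs with h1 h2 h2
        · rfl
        · exact absurd h1.2 h2
        · exact hQ0 y
        · rfl
    _ = ∑ y, Q y := by simp
    _ ≤ 1 := hQ1

open Classical in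
/-- One-shot converse for erased outputs, relative to reference measures `q v t`. -/
theorem erasure_converse (D : V → U → Fin n → Z) (dec : (Fin n → Option Z) → V × U)
    (q : V → Fin n → Z → ℝ) (hq0 : ∀ v t z, 0 ≤ q v t z) (hq1 : ∀ v t, ∑ z, q v t z ≤ 1)
    (hqpos : ∀ v u t, 0 < q v t (D v u t)) {δ l : ℝ} (h0 : 0 ≤ δ) (h1 : δ ≤ 1) (hl : 0 < l) :
    ∑ v, ∑ u, ∑ b : Fin n → Bool, (∏ t, bern δ (b t)) *
        (if dec (fun t => letter (b t) (D v u t)) = (v, u) then 1 else 0) ≤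
      Fintype.card V * Real.exp l +
        δ / l * ∑ v, ∑ u, ∑ t, -Real.log (q v t (D v u t)) := by
  have hβ (b : Fin n → Bool) : 0 ≤ ∏ t, bern δ (b t) :=
    Finset.prod_nonneg fun t _ => bern_nonneg h0 h1 _
  have hL (v u t) : 0 ≤ -Real.log (q v t (D v u t)) := by
    refine neg_nonneg.2 (Real.log_nonpos (hq0 _ _ _) ?_)
    exact (Finset.single_le_sum (fun z _ => hq0 v t z) (Finset.mem_univ _)).trans (hq1 v t)
  -- Let `s` be the log-loss over unerased positions. If `s ≤ l`, the first term is at least 1 for a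
  -- correctly decoded word; otherwise `s / l ≥ 1`, as in Markov's inequality.
  have hpt (v u) (b : Fin n → Bool) :
      (if dec (fun t => letter (b t) (D v u t)) = (v, u) then (1 : ℝ) else 0) ≤
      Real.exp l * ((if (dec (fun t => letter (b t) (D v u t))).2 = u then 1 else 0) *
        ∏ t, if b t then q v t (D v u t) else 1) +
      l⁻¹ * ∑ t, (if b t then 1 else 0) * -Real.log (q v t (D v u t)) := by
    have hprod : ∏ t, (if b t then q v t (D v u t) else 1) =
        Real.exp (-∑ t, (if b t then 1 else 0) * -Real.log (q v t (D v u t))) := by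
      rw [← Finset.sum_neg_distrib, Real.exp_sum]
      refine Finset.prod_congr rfl fun t _ => ?_
      split_ifs
      · rw [one_mul, neg_neg, Real.exp_log (hqpos v u t)]
      · simp
    have hs : 0 ≤ ∑ t, (if b t then (1 : ℝ) else 0) * -Real.log (q v t (D v u t)) :=
      Finset.sum_nonneg fun t _ => mul_nonneg (by split_ifs <;> simp) (hL v u t)
    rw [hprod]
    set s := ∑ t, (if b t then (1 : ℝ) else 0) * -Real.log (q v t (D v u t))
    by_cases hd : dec (fun t => letter (b t) (D v u t)) = (v, u)
    · rw [if_pos hd, if_pos (by rw [hd]), one_mul, ← Real.exp_add]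
      have h2 : 0 ≤ l⁻¹ * s := by positivity
      rcases le_total s l with h | h
      · have : 1 ≤ Real.exp (l + -s) := Real.one_le_exp (by linarith)
        linarith
      · have : 1 ≤ l⁻¹ * s := by
          rw [inv_mul_eq_div, one_le_div hl]; exact h
        linarith [Real.exp_pos (l + -s)]
    · rw [if_neg hd]
      have : (0 : ℝ) ≤ if (dec (fun t => letter (b t) (D v u t))).2 = u then 1 else 0 := by
        split_ifs <;> simp
      positivity
  calc _ ≤ ∑ v, ∑ u, ∑ b : Fin n → Bool, (∏ t, bern δ (b t)) *
        (Real.exp l * ((if (dec (fun t => letter (b t) (D v u t))).2 = u then 1 else 0) *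
          ∏ t, if b t then q v t (D v u t) else 1) +
        l⁻¹ * ∑ t, (if b t then 1 else 0) * -Real.log (q v t (D v u t))) :=
        Finset.sum_le_sum fun v _ => Finset.sum_le_sum fun u _ => Finset.sum_le_sum fun b _ =>
          mul_le_mul_of_nonneg_left (hpt v u b) (hβ b)
    _ = ∑ v, ∑ b : Fin n → Bool, (∏ t, bern δ (b t)) * (Real.exp l *
          ∑ u, (if (dec (fun t => letter (b t) (D v u t))).2 = u then 1 else 0) *
          ∏ t, if b t then q v t (D v u t) else 1) +
        l⁻¹ * ∑ v, ∑ u, ∑ t, (∑ b : Fin n → Bool, (∏ t, bern δ (b t)) *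
          (if b t then 1 else 0)) * -Real.log (q v t (D v u t)) := by
        simp only [mul_add, Finset.sum_add_distrib]
        congr 1
        · refine Finset.sum_congr rfl fun v _ => ?_
          rw [Finset.sum_comm]
          simp only [Finset.mul_sum]
        · simp only [Finset.mul_sum, Finset.sum_mul]
          refine Finset.sum_congr rfl fun v _ => Finset.sum_congr rfl fun u _ => ?_
          rw [Finset.sum_comm]
          refine Finset.sum_congr rfl fun t _ => Finset.sum_congr rfl fun b _ => ?_
          ring
    _ ≤ _ := by
        simp only [sum_prod_bern_mul]
        refine add_le_add ?_ (le_of_eq ?_)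
        · calc _ ≤ ∑ v : V, ∑ b : Fin n → Bool, (∏ t, bern δ (b t)) * (Real.exp l * 1) := by
                refine Finset.sum_le_sum fun v _ => Finset.sum_le_sum fun b _ =>
                  mul_le_mul_of_nonneg_left (mul_le_mul_of_nonneg_left ?_ (Real.exp_pos l).le)
                    (hβ b)
                convert sum_correct_le (D v) (fun y => (dec y).2) (q v) (hq0 v) (hq1 v) b
            _ = _ := by
                simp only [← Finset.sum_mul, sum_prod_bern]
                simp
        · simp only [← Finset.mul_sum]
          ring

end

/-- Replace the messages in `S` by those of `w`. -/
def merge {K : Fin 7 → ℕ} (S : Finset (Fin 7)) (w₀ w : Messages K) : Messages K :=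
  fun I => if I ∈ S then w I else w₀ I

/-- The messages outside `S` are treated as given (`V`), those in `S` as unknown (`U`). The
reference measure is the product of the per-link ones, so log-losses add over links. -/
theorem Code.converse {k : Fin 7 → ℕ} {δ : ℝ} {h0 : 0 ≤ δ} {h1 : δ ≤ 1} {K : Fin 7 → ℕ} {n : ℕ}
    (c : Code (linkChannel k δ h0 h1) K n) (hK : ∀ I, 0 < K I) (S : Finset (Fin 7))
    (κ : Fin 7 → ℝ)
    (hκ : ∀ J t w₀, ∃ q : Option (Fin (k J)) → ℝ, (∀ o, 0 ≤ q o) ∧ ∑ o, q o ≤ 1 ∧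
      (∀ w, 0 < q (c.noiseless (merge S w₀ w) t J)) ∧
      ∑ w, -Real.log (q (c.noiseless (merge S w₀ w) t J)) ≤ Fintype.card (Messages K) * κ J)
    {l : ℝ} (hl : 0 < l) :
    1 - c.errorProb ≤ Real.exp l / ∏ I ∈ S, (K I : ℝ) + δ / l * (n * ∑ J, κ J) := by
  classical
  have hne (I : Fin 7) : Nonempty (Fin (K I)) := ⟨⟨0, hK I⟩⟩
  choose q hq0 hq1 hqpos hqlog using hκ
  let V := ∀ I : {I // I ∉ S}, Fin (K I)
  let U := ∀ I : {I // ¬ I ∉ S}, Fin (K I)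
  let e : Messages K ≃ V × U := Equiv.piEquivPiSubtypeProd (fun I => I ∉ S) fun I => Fin (K I)
  -- A dummy: `merge` overwrites these coordinates.
  let u₀ : U := fun I => Classical.arbitrary _
  have hmerge (v : V) (w : Messages K) : merge S (e.symm (v, u₀)) w = e.symm (v, (e w).2) := by
    funext I
    show (if I ∈ S then w I else (if h : I ∉ S then v ⟨I, h⟩ else u₀ ⟨I, h⟩)) =
      if h : I ∉ S then v ⟨I, h⟩ else w I
    by_cases hI : I ∈ S <;> simp [hI]
  have hU : (Fintype.card U : ℝ) = ∏ I ∈ S, (K I : ℝ) := by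
    simp only [U, Fintype.card_pi, Fintype.card_fin]
    rw [← Finset.prod_coe_sort S]
    push_cast
    exact Fintype.prod_equiv (Equiv.subtypeEquivRight fun I => by simp) _ _ fun _ => rfl
  have hV0 : (0 : ℝ) < Fintype.card V := by exact_mod_cast Fintype.card_pos
  have hU0 : (0 : ℝ) < Fintype.card U := by exact_mod_cast Fintype.card_pos
  have hM : (Fintype.card (Messages K) : ℝ) = Fintype.card V * Fintype.card U := by
    rw [Fintype.card_congr e, Fintype.card_prod]; push_cast; rfl
  have main := erasure_converse (fun v u t => c.noiseless (e.symm (v, u)) t)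
    (fun y => e (c.linkDec y)) (fun v t z => ∏ J, q J t (e.symm (v, u₀)) (z J))
    (fun v t z => Finset.prod_nonneg fun J _ => hq0 _ _ _ _)
    (fun v t => by
      have := Finset.prod_univ_sum (fun J => (Finset.univ : Finset (Option (Fin (k J)))))
        fun J o => q J t (e.symm (v, u₀)) o
      rw [Fintype.piFinset_univ] at this
      rw [← this]
      exact Finset.prod_le_one (fun J _ => Finset.sum_nonneg fun o _ => hq0 _ _ _ _)
        fun J _ => hq1 _ _ _)
    (fun v u t => Finset.prod_pos fun J _ => by
      have := hqpos J t (e.symm (v, u₀)) (e.symm (v, u))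
      rwa [hmerge, Equiv.apply_symm_apply] at this) h0 h1 hl
  have hcost : ∑ v : V, ∑ u : U, ∑ t, -Real.log (∏ J, q J t (e.symm (v, u₀))
      (c.noiseless (e.symm (v, u)) t J)) ≤
      Fintype.card V * (Fintype.card U * (n * ∑ J, κ J)) := by
    have hvt (v : V) (t : Fin n) (J : Fin 7) :
        ∑ u : U, -Real.log (q J t (e.symm (v, u₀)) (c.noiseless (e.symm (v, u)) t J)) ≤
        Fintype.card U * κ J := by
      have := hqlog J t (e.symm (v, u₀))
      rw [← Equiv.sum_comp e.symm, Fintype.sum_prod_type] at this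
      simp only [hmerge, Equiv.apply_symm_apply, Finset.sum_const, Finset.card_univ,
        nsmul_eq_mul, hM] at this
      rw [mul_assoc] at this
      exact le_of_mul_le_mul_left this hV0
    calc _ = ∑ v : V, ∑ t : Fin n, ∑ J,
          ∑ u : U, -Real.log (q J t (e.symm (v, u₀)) (c.noiseless (e.symm (v, u)) t J)) := by
          refine Finset.sum_congr rfl fun v _ => ?_
          rw [Finset.sum_comm]
          refine Finset.sum_congr rfl fun t _ => ?_
          rw [Finset.sum_comm]
          refine Finset.sum_congr rfl fun u _ => ?_
          rw [Real.log_prod fun J _ => ?_, Finset.sum_neg_distrib]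
          have := hqpos J t (e.symm (v, u₀)) (e.symm (v, u))
          rw [hmerge, Equiv.apply_symm_apply] at this
          exact this.ne'
      _ ≤ ∑ v : V, ∑ t : Fin n, ∑ J, Fintype.card U * κ J :=
          Finset.sum_le_sum fun v _ => Finset.sum_le_sum fun t _ => Finset.sum_le_sum fun J _ =>
            hvt v t J
      _ = _ := by
          simp only [← Finset.mul_sum, Finset.sum_const, Finset.card_univ, nsmul_eq_mul,
            Fintype.card_fin]
          ring
  have hsucc : (Fintype.card (Messages K) : ℝ) * (1 - c.errorProb) =
      ∑ v : V, ∑ u : U, ∑ b : Fin n → Bool, (∏ t, bern δ (b t)) *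
        (if e (c.linkDec fun t => letter (b t) (c.noiseless (e.symm (v, u)) t)) = (v, u)
          then 1 else 0) := by
    have hM0 : (Fintype.card (Messages K) : ℝ) ≠ 0 := by rw [hM]; positivity
    rw [Code.errorProb_link, mul_sub, mul_one, mul_inv_cancel_left₀ hM0,
      ← Fintype.sum_prod_type fun p : V × U => ∑ b : Fin n → Bool, (∏ t, bern δ (b t)) *
        (if e (c.linkDec fun t => letter (b t) (c.noiseless (e.symm p) t)) = p
          then (1 : ℝ) else 0),
      ← Equiv.sum_comp e, sub_eq_iff_eq_add, ← Finset.sum_add_distrib]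
    rw [show (Fintype.card (Messages K) : ℝ) = ∑ w : Messages K, (1 : ℝ) by simp]
    refine Finset.sum_congr rfl fun w _ => ?_
    rw [← Finset.sum_add_distrib]
    refine (sum_prod_bern δ n).symm.trans ?_
    refine Finset.sum_congr rfl fun b _ => ?_
    rw [← mul_add]
    simp only [Equiv.symm_apply_apply, EmbeddingLike.apply_eq_iff_eq]
    by_cases h : (c.linkDec fun t => letter (b t) (c.noiseless w t)) = w <;> simp [h]
  have hfin : Fintype.card V * Fintype.card U * (1 - c.errorProb) ≤
      Fintype.card V * Real.exp l +
        δ / l * (Fintype.card V * (Fintype.card U * (n * ∑ J, κ J))) := by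
    rw [← hM, hsucc]
    refine le_trans (le_of_eq ?_) (main.trans (add_le_add_right
      (mul_le_mul_of_nonneg_left hcost (by positivity)) _))
    congr!
  rw [← hU, div_add' _ _ _ hU0.ne', le_div_iff₀ hU0]
  refine le_of_mul_le_mul_left ?_ hV0
  linarith

/-- `κ J` bounds the information per channel use that link `J` carries about the messages in `S`,
once the others are known. -/
def LinkCost (k : Fin 7 → ℕ) (S : Finset (Fin 7)) (J : Fin 7) (κ : ℝ) : Prop :=
  ∀ (K : Fin 7 → ℕ), (∀ I, 0 < K I) →
    ∀ (x : ∀ i : Fin 3, LocalMessages K i → ∀ J, Fin (k J)) (w₀ : Messages K),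
    ∃ q : Option (Fin (k J)) → ℝ, (∀ o, 0 ≤ q o) ∧ ∑ o, q o ≤ 1 ∧
      (∀ w, 0 < q (linkOutput (fun i => x i (localPart (merge S w₀ w) i)) J)) ∧
      ∑ w, -Real.log (q (linkOutput (fun i => x i (localPart (merge S w₀ w) i)) J)) ≤
        Fintype.card (Messages K) * κ

theorem Achievable.converse {k : Fin 7 → ℕ} {δ : ℝ} {h0 : 0 ≤ δ} {h1 : δ ≤ 1}
    {S : Finset (Fin 7)} {κ : Fin 7 → ℝ} (hκ0 : ∀ J, 0 ≤ κ J) (hκ : ∀ J, LinkCost k S J (κ J))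
    {R : Fin 7 → ℝ} (h : Achievable (linkChannel k δ h0 h1) R) :
    (∑ I ∈ S, R I) * Real.log 2 ≤ δ * ∑ J, κ J := by
  obtain ⟨hR, c, hc⟩ := h
  set r := (∑ I ∈ S, R I) * Real.log 2 with hr
  set B := δ * ∑ J, κ J with hB
  have hB0 : 0 ≤ B := mul_nonneg h0 (Finset.sum_nonneg fun J _ => hκ0 J)
  by_contra! hlt
  -- With threshold `l = n * μ`, the term `exp l / ∏ K I` decays because `μ < r`, which leaves
  -- success probability at most `B / μ < 1` in the limit.
  obtain ⟨μ, hBμ, hμr⟩ := exists_between hlt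
  have hμ0 : 0 < μ := hB0.trans_lt hBμ
  have hprod (n : ℕ) : Real.exp (n * r) ≤ 2 ^ S.card * ∏ I ∈ S, (numMessages R n I : ℝ) := by
    have e : Real.exp (n * r) = ∏ I ∈ S, (2 : ℝ) ^ (n * R I) := by
      rw [← Real.rpow_sum_of_pos zero_lt_two, ← Finset.mul_sum, Real.rpow_def_of_pos zero_lt_two,
        hr]
      ring_nf
    rw [e, ← Finset.prod_const, ← Finset.prod_mul_distrib]
    refine Finset.prod_le_prod (fun I _ => by positivity) fun I _ => ?_
    have h2 := Nat.lt_floor_add_one ((2 : ℝ) ^ (n * R I))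
    have h3 : (1 : ℝ) ≤ numMessages R n I := by exact_mod_cast numMessages_pos hR n I
    have h4 : (numMessages R n I : ℝ) = ⌊(2 : ℝ) ^ (n * R I)⌋₊ := rfl
    linarith
  have hbound (n : ℕ) (hn : 0 < n) :
      1 - (c n).errorProb ≤ 2 ^ S.card * Real.exp (μ - r) ^ n + B / μ := by
    have hnR : (0 : ℝ) < n := by exact_mod_cast hn
    have := (c n).converse (numMessages_pos hR n) S κ
      (fun J t w₀ => hκ J _ (numMessages_pos hR n) (fun i l => (c n).enc i l t) w₀)
      (l := n * μ) (by positivity)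
    refine this.trans (add_le_add ?_ (le_of_eq ?_))
    · have hP : 0 < ∏ I ∈ S, (numMessages R n I : ℝ) :=
        Finset.prod_pos fun I _ => by exact_mod_cast numMessages_pos hR n I
      rw [div_le_iff₀ hP, ← Real.exp_nat_mul]
      calc Real.exp (n * μ) = Real.exp (n * (μ - r)) * Real.exp (n * r) := by
            rw [← Real.exp_add]; ring_nf
        _ ≤ Real.exp (n * (μ - r)) * (2 ^ S.card * ∏ I ∈ S, (numMessages R n I : ℝ)) :=
            mul_le_mul_of_nonneg_left (hprod n) (Real.exp_pos _).le
        _ = _ := by ring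
    · rw [hB]
      field_simp
  have hlim1 : Tendsto (fun n => 1 - (c n).errorProb) atTop (𝓝 (1 - 0)) :=
    tendsto_const_nhds.sub hc
  have hlim2 : Tendsto (fun n : ℕ => 2 ^ S.card * Real.exp (μ - r) ^ n + B / μ) atTop
      (𝓝 (2 ^ S.card * 0 + B / μ)) := by
    refine ((tendsto_pow_atTop_nhds_zero_of_lt_one (Real.exp_pos _).le ?_).const_mul _).add_const _
    rw [Real.exp_lt_one_iff]
    linarith
  have := le_of_tendsto_of_tendsto hlim1 hlim2
    ((eventually_gt_atTop 0).mono fun n hn => hbound n hn)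
  rw [mul_zero, zero_add, sub_zero, one_le_div hμ0] at this
  linarith

theorem capacityRegion_converse {k : Fin 7 → ℕ} {δ : ℝ} {h0 : 0 ≤ δ} {h1 : δ ≤ 1}
    {S : Finset (Fin 7)} {κ : Fin 7 → ℝ} (hκ0 : ∀ J, 0 ≤ κ J) (hκ : ∀ J, LinkCost k S J (κ J))
    {R : Fin 7 → ℝ} (h : R ∈ capacityRegion (linkChannel k δ h0 h1)) :
    (∑ I ∈ S, R I) * Real.log 2 ≤ δ * ∑ J, κ J := by
  have hclosed : IsClosed {R : Fin 7 → ℝ | (∑ I ∈ S, R I) * Real.log 2 ≤ δ * ∑ J, κ J} :=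
    isClosed_le (by fun_prop) continuous_const
  exact closure_minimal (fun R hR => hR.converse hκ0 hκ) hclosed h

/-! ### Costs of the links -/

theorem linkOutput_of_agree {k : Fin 7 → ℕ} {x : Fin 3 → ∀ J, Fin (k J)} {J : Fin 7}
    (h : ∀ i ∈ users J, x i J = x (firstUser J) J) : linkOutput x J = some (x (firstUser J) J) :=
  if_pos h

/-- A link whose transmitters always agree costs at most the logarithm of its alphabet size. -/
theorem linkCost_log {k : Fin 7 → ℕ} (hk : ∀ J, 0 < k J) (S : Finset (Fin 7)) {J : Fin 7}
    (hJ : users J = {firstUser J} ∨ k J = 1) : LinkCost k S J (Real.log (k J)) := by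
  intro K hK x w₀
  have hkR : (0 : ℝ) < k J := by exact_mod_cast hk J
  have hout (w : Messages K) : ∃ a, linkOutput (fun i => x i (localPart w i)) J = some a := by
    refine ⟨_, linkOutput_of_agree fun i hi => ?_⟩
    rcases hJ with h | h
    · rw [h, Finset.mem_singleton] at hi
      rw [hi]
    · have : Subsingleton (Fin (k J)) := by rw [h]; infer_instance
      exact Subsingleton.elim _ _
  choose a ha using hout
  refine ⟨fun o => o.elim 0 fun _ => (k J : ℝ)⁻¹, fun o => ?_, ?_, fun w => ?_, ?_⟩
  · cases o <;> simp
  · rw [Fintype.sum_option]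
    simp [hkR.ne']
  · rw [ha]
    exact inv_pos.2 hkR
  · simp only [ha, Option.elim, Real.log_inv, neg_neg, Finset.sum_const, Finset.card_univ,
      nsmul_eq_mul]
    rfl

/-- A link whose transmitters know no message of `S` costs nothing. -/
theorem linkCost_zero (k : Fin 7 → ℕ) (S : Finset (Fin 7)) {J : Fin 7}
    (hJ : ∀ I ∈ S, Disjoint (users I) (users J)) : LinkCost k S J 0 := by
  intro K hK x w₀
  classical
  have hout (w : Messages K) : linkOutput (fun i => x i (localPart (merge S w₀ w) i)) J =
      linkOutput (fun i => x i (localPart w₀ i)) J := by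
    have (i : Fin 3) (hi : i ∈ users J) : localPart (merge S w₀ w) i = localPart w₀ i := by
      funext ⟨I, hI⟩
      refine if_neg fun hIS => ?_
      exact Finset.disjoint_left.1 (hJ I hIS) hI hi
    unfold linkOutput
    simp only [this _ (firstUser_mem J)]
    congr 1
    refine propext (forall₂_congr fun i hi => ?_)
    rw [this i hi]
  refine ⟨fun o => if o = linkOutput (fun i => x i (localPart w₀ i)) J then 1 else 0,
    fun o => by dsimp only; split_ifs <;> simp, by simp, fun w => ?_, ?_⟩
  · simp [hout]
  · simp [hout]

/-- From `log y ≤ y - 1` at `y = 1 / √p`. A factor `√p` in the agreement probability thus absorbs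
the log-loss, independently of the alphabet size. -/
theorem sqrt_mul_neg_log_le {p : ℝ} (hp0 : 0 ≤ p) : √p * -Real.log p ≤ 2 := by
  rcases hp0.eq_or_lt with h | h
  · simp [← h]
  · have hs : 0 < √p := Real.sqrt_pos.2 h
    have h1 := Real.log_le_sub_one_of_pos (inv_pos.2 hs)
    rw [Real.log_inv, Real.log_sqrt h.le] at h1
    have h2 : √p * (-(Real.log p / 2)) ≤ √p * ((√p)⁻¹ - 1) := mul_le_mul_of_nonneg_left h1 hs.le
    rw [mul_sub, mul_inv_cancel₀ hs.ne'] at h2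
    linarith

/-- If the event that a partial output is `x` is less likely, in the stated sense, than the event
that the letter of one transmitter is `x`, then the output carries a bounded amount of
information. -/
theorem exists_reference_of_agreement {W A : Type} [Fintype W] [Nonempty W] [Fintype A]
    [DecidableEq A] (out : W → Option A) (a : W → A) (hout : ∀ w x, out w = some x → a w = x)
    (r : A → ℝ) (hr0 : ∀ x, 0 ≤ r x) (hr1 : ∑ x, r x ≤ 1)
    (hr : ∀ x, (∑ w, if out w = some x then (1 : ℝ) else 0) / Fintype.card W ≤
      √((∑ w, if a w = x then (1 : ℝ) else 0) / Fintype.card W) * r x) :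
    ∃ q : Option A → ℝ, (∀ o, 0 ≤ q o) ∧ ∑ o, q o ≤ 1 ∧ (∀ w, 0 < q (out w)) ∧
      ∑ w, -Real.log (q (out w)) ≤ Fintype.card W * 3 := by
  have hW : (0 : ℝ) < Fintype.card W := by exact_mod_cast Fintype.card_pos
  let p (x : A) : ℝ := (∑ w, if a w = x then (1 : ℝ) else 0) / Fintype.card W
  have hp0 (x) : 0 ≤ p x :=
    div_nonneg (Finset.sum_nonneg fun w _ => by split_ifs <;> simp) hW.le
  have hppos (w : W) : 0 < p (a w) := by
    refine div_pos ?_ hW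
    have := Finset.single_le_sum (s := Finset.univ) (f := fun w' => if a w' = a w then (1 : ℝ) else 0)
      (fun w _ => by split_ifs <;> simp) (Finset.mem_univ w)
    simp only [if_true] at this
    linarith
  have hp1 : ∑ x, p x = 1 := by
    simp only [p]
    rw [← Finset.sum_div, Finset.sum_comm]
    simp [hW.ne']
  -- Half the mass is put on disagreement and half follows the law of the one transmitter's letter.
  -- The halving costs `log 2 ≤ 1`, and the agreements cost `∑ 2 * r x ≤ 2`.
  refine ⟨fun o => o.elim (1 / 2) fun x => p x / 2, fun o => ?_, ?_, fun w => ?_, ?_⟩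
  · cases o
    · simp
    · exact div_nonneg (hp0 _) zero_le_two
  · rw [Fintype.sum_option]
    simp only [Option.elim, ← Finset.sum_div, hp1]
    norm_num
  · cases h : out w with
    | none => simp
    | some x =>
      have := hppos w
      rw [hout w x h] at this
      exact half_pos this
  · have hlog2 : Real.log 2 ≤ 1 := by linarith [Real.log_two_lt_d9]
    have hw (w : W) : -Real.log ((out w).elim (1 / 2) fun x => p x / 2) ≤
        1 + ∑ x, (if out w = some x then 1 else 0) * -Real.log (p x) := by
      cases h : out w with
      | none =>
        simp only [Option.elim, one_div, Real.log_inv, neg_neg]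
        simpa using hlog2
      | some x =>
        have := hppos w
        rw [hout w x h] at this
        simp only [Option.elim, Option.some.injEq, ite_mul, one_mul, zero_mul, Finset.sum_ite_eq,
          Finset.mem_univ, if_true]
        rw [Real.log_div this.ne' two_ne_zero]
        linarith
    have hx (x : A) : ∑ w, (if out w = some x then 1 else 0) * -Real.log (p x) ≤
        Fintype.card W * (2 * r x) := by
      have hp1x : p x ≤ 1 := hp1 ▸ Finset.single_le_sum (fun x _ => hp0 x) (Finset.mem_univ x)
      have hlog : 0 ≤ -Real.log (p x) := neg_nonneg.2 (Real.log_nonpos (hp0 x) hp1x)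
      rw [← Finset.sum_mul]
      have h1 := hr x
      rw [div_le_iff₀ hW] at h1
      calc _ ≤ √(p x) * r x * Fintype.card W * -Real.log (p x) :=
            mul_le_mul_of_nonneg_right h1 hlog
        _ = Fintype.card W * ((√(p x) * -Real.log (p x)) * r x) := by ring
        _ ≤ _ := mul_le_mul_of_nonneg_left
            (mul_le_mul_of_nonneg_right (sqrt_mul_neg_log_le (hp0 x)) (hr0 x)) hW.le
    calc _ ≤ ∑ w, (1 + ∑ x, (if out w = some x then 1 else 0) * -Real.log (p x)) :=
          Finset.sum_le_sum fun w _ => hw w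
      _ = Fintype.card W + ∑ x, ∑ w, (if out w = some x then 1 else 0) * -Real.log (p x) := by
          rw [Finset.sum_add_distrib, Finset.sum_comm]
          simp
      _ ≤ Fintype.card W + ∑ x, Fintype.card W * (2 * r x) :=
          add_le_add_right (Finset.sum_le_sum fun x _ => hx x) _
      _ ≤ Fintype.card W * 3 := by
          rw [← Finset.mul_sum, ← Finset.mul_sum]
          nlinarith

theorem linkOutput_eq_some_iff {k : Fin 7 → ℕ} {x : Fin 3 → ∀ J, Fin (k J)} {J : Fin 7}
    {a : Fin (k J)} : linkOutput x J = some a ↔ ∀ i ∈ users J, x i J = a := by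
  unfold linkOutput
  constructor
  · intro h i hi
    split_ifs at h with h'
    rw [h' i hi]
    exact Option.some.inj h
  · intro h
    rw [if_pos fun i hi => (h i hi).trans (h _ (firstUser_mem J)).symm, h _ (firstUser_mem J)]

section

variable {K : Fin 7 → ℕ}

theorem merge_merge_swap (T : Finset (Fin 7)) (w w' : Messages K) :
    merge T (merge T w w') (merge T w' w) = w := by
  funext I
  by_cases h : I ∈ T <;> simp [merge, h]

/-- Exchanging the messages in `T` between two independent message vectors. -/
def mergeEquiv (T : Finset (Fin 7)) : Messages K × Messages K ≃ Messages K × Messages K where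
  toFun p := (merge T p.1 p.2, merge T p.2 p.1)
  invFun p := (merge T p.1 p.2, merge T p.2 p.1)
  left_inv p := by simp [merge_merge_swap]
  right_inv p := by simp [merge_merge_swap]

theorem sum_sum_merge (T : Finset (Fin 7)) (F : Messages K → Messages K → ℝ) :
    ∑ w, ∑ w', F (merge T w w') (merge T w' w) = ∑ w, ∑ w', F w w' := by
  rw [← Fintype.sum_prod_type', ← Fintype.sum_prod_type']
  exact Equiv.sum_comp (mergeEquiv T) fun p : Messages K × Messages K => F p.1 p.2

/-- Independence of functions of disjoint sets of messages, by exchanging the `T`-parts of two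
independent copies. -/
theorem sum_mul_sum_of_dependsOn {T : Finset (Fin 7)} {f g : Messages K → ℝ}
    (hf : DependsOn f (T : Set (Fin 7))) (hg : DependsOn g (T : Set (Fin 7))ᶜ) :
    (∑ w, f w) * ∑ w, g w = Fintype.card (Messages K) * ∑ w, f w * g w := by
  rw [Finset.sum_mul_sum, ← sum_sum_merge T]
  have (w w' : Messages K) : f (merge T w w') * g (merge T w' w) = f w' * g w' := by
    congr 1
    · exact hf fun I hI => if_pos hI
    · exact hg fun I hI => if_neg hI
  simp only [this]
  simp

/-- A discrete Loomis-Whitney (Finner) inequality for functions of overlapping message triples. -/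
theorem sq_sum_mul_mul_le {T : Finset (Fin 7)} {A : Finset (Fin 7)} {f g h : Messages K → ℝ}
    (hf : DependsOn f (T : Set (Fin 7))ᶜ) (hg : DependsOn g (T ∪ A : Set (Fin 7)))
    (hh : DependsOn h ((T : Set (Fin 7)) ∪ (A : Set (Fin 7))ᶜ))
    (hf1 : ∀ w, f w ^ 2 = f w) (hg1 : ∀ w, g w ^ 2 = g w) (hh1 : ∀ w, h w ^ 2 = h w) :
    Fintype.card (Messages K) * (∑ w, f w * (g w * h w)) ^ 2 ≤
      (∑ w, f w) * ((∑ w, g w) * ∑ w, h w) := by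
  rcases isEmpty_or_nonempty (Messages K) with hM | hM
  · simp
  have hcard : (0 : ℝ) < Fintype.card (Messages K) := by exact_mod_cast Fintype.card_pos
  -- Summing out `T` leaves `f` untouched. Cauchy-Schwarz separates `g` from `h` inside `avg`, then
  -- `f` from the average; `avg g` and `avg h` depend on `A` and on its complement, so they are
  -- independent.
  let avg (φ : Messages K → ℝ) (w : Messages K) : ℝ := ∑ w', φ (merge T w w')
  have havg (φ : Messages K → ℝ) : ∑ w, avg φ w = Fintype.card (Messages K) * ∑ w, φ w := by
    rw [sum_sum_merge T fun w _ => φ w]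
    simp [Finset.mul_sum]
  have h1 : ∑ w, f w * avg (fun w => g w * h w) w =
      Fintype.card (Messages K) * ∑ w, f w * (g w * h w) := by
    rw [← havg]
    refine Finset.sum_congr rfl fun w _ => ?_
    rw [Finset.mul_sum]
    refine Finset.sum_congr rfl fun w' _ => ?_
    dsimp only
    rw [hf (x := merge T w w') (y := w) fun I hI => if_neg hI]
  have h2 (w) : avg (fun w => g w * h w) w ^ 2 ≤ avg g w * avg h w := by
    have := Finset.sum_mul_sq_le_sq_mul_sq Finset.univ (fun w' => g (merge T w w'))
      fun w' => h (merge T w w')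
    simpa only [hg1, hh1] using this
  have h3 : (∑ w, f w * avg (fun w => g w * h w) w) ^ 2 ≤
      (∑ w, f w) * ∑ w, avg (fun w => g w * h w) w ^ 2 := by
    have := Finset.sum_mul_sq_le_sq_mul_sq Finset.univ f (avg fun w => g w * h w)
    simpa only [hf1] using this
  have hf0 : 0 ≤ ∑ w, f w := Finset.sum_nonneg fun w _ => hf1 w ▸ sq_nonneg _
  have h4 : (∑ w, avg g w) * ∑ w, avg h w =
      Fintype.card (Messages K) * ∑ w, avg g w * avg h w := by
    refine sum_mul_sum_of_dependsOn (T := A) ?_ ?_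
    · intro w v hwv
      refine Finset.sum_congr rfl fun w' _ => hg fun I hI => ?_
      by_cases hT : I ∈ T
      · simp [merge, hT]
      · simpa [merge, hT] using hwv I (hI.resolve_left hT)
    · intro w v hwv
      refine Finset.sum_congr rfl fun w' _ => hh fun I hI => ?_
      by_cases hT : I ∈ T
      · simp [merge, hT]
      · simpa [merge, hT] using hwv I (hI.resolve_left hT)
  rw [havg, havg] at h4
  have h5 : (Fintype.card (Messages K) * ∑ w, f w * (g w * h w)) ^ 2 ≤
      (∑ w, f w) * ∑ w, avg g w * avg h w := by
    rw [← h1]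
    exact h3.trans (mul_le_mul_of_nonneg_left (Finset.sum_le_sum fun w _ => h2 w) hf0)
  have h6 : ∑ w, avg g w * avg h w =
      Fintype.card (Messages K) * ((∑ w, g w) * ∑ w, h w) := by
    refine mul_left_cancel₀ hcard.ne' ?_
    rw [← h4]
    ring
  rw [h6] at h5
  refine le_of_mul_le_mul_left (le_trans (le_of_eq ?_) (h5.trans (le_of_eq ?_))) hcard <;> ring

/-- The messages in `S` that a transmitter sees determine its letter, the others being fixed. -/
theorem dependsOn_localPart {β : Type*} (S : Finset (Fin 7)) (w₀ : Messages K) (i : Fin 3)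
    (F : LocalMessages K i → β) :
    DependsOn (fun w => F (localPart (merge S w₀ w) i)) {I | I ∈ S ∧ i ∈ users I} := by
  intro w v h
  dsimp only
  congr 1
  funext ⟨I, hI⟩
  by_cases hS : I ∈ S
  · simpa [localPart, merge, hS] using h I ⟨hS, hI⟩
  · simp [localPart, merge, hS]

end

/-- The messages that are not known to all transmitters of `users J`. -/
def notAbove (J : Fin 7) : Finset (Fin 7) :=
  Finset.univ.filter fun I => ¬ users J ⊆ users I

/-- Messages of `S` seen by one transmitter are not seen by the other, so their letters are
independent and agree on `y` with probability `p * p' ≤ √p * p'`. -/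
theorem linkCost_pair (k : Fin 7 → ℕ) {J : Fin 7} {j : Fin 3}
    (hJ : users J = {firstUser J, j}) : LinkCost k (notAbove J) J 3 := by
  intro K hK x w₀
  have : Nonempty (Messages K) := ⟨fun I => ⟨0, hK I⟩⟩
  have hW : (0 : ℝ) < Fintype.card (Messages K) := by exact_mod_cast Fintype.card_pos
  set i := firstUser J with hi
  let a (i : Fin 3) (w : Messages K) : Fin (k J) :=
    x i (localPart (merge (notAbove J) w₀ w) i) J
  have hout (w : Messages K) (y : Fin (k J)) :
      linkOutput (fun i => x i (localPart (merge (notAbove J) w₀ w) i)) J = some y ↔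
        a i w = y ∧ a j w = y := by
    rw [linkOutput_eq_some_iff, hJ]
    simp [a]
  refine exists_reference_of_agreement _ (a i) (fun w y h => ((hout w y).1 h).1)
    (fun y => (∑ w, if a j w = y then (1 : ℝ) else 0) / Fintype.card (Messages K))
    (fun y => div_nonneg (Finset.sum_nonneg fun w _ => by split_ifs <;> simp) hW.le) ?_ fun y => ?_
  · rw [← Finset.sum_div, Finset.sum_comm, div_le_one hW]
    simp
  · have hind := sum_mul_sum_of_dependsOn (K := K)
      (T := (notAbove J).filter fun I => i ∈ users I)
      (f := fun w => if a i w = y then (1 : ℝ) else 0)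
      (g := fun w => if a j w = y then (1 : ℝ) else 0)
      (by
        have := dependsOn_localPart (notAbove J) w₀ i fun l => if x i l J = y then (1 : ℝ) else 0
        simpa using this)
      (by
        have := dependsOn_localPart (notAbove J) w₀ j fun l => if x j l J = y then (1 : ℝ) else 0
        refine DependsOn.mono ?_ this
        rintro I ⟨hI, hjI⟩ hI'
        have hI2 : i ∈ users I := (Finset.mem_filter.1 hI').2
        refine (Finset.mem_filter.1 hI).2 ?_
        rw [hJ]
        intro m hm
        rcases Finset.mem_insert.1 hm with rfl | hm
        · exact hI2
        · rw [Finset.mem_singleton.1 hm]; exact hjI)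
    set p : ℝ := (∑ w, if a i w = y then (1 : ℝ) else 0) / Fintype.card (Messages K) with hp
    set p' : ℝ := (∑ w, if a j w = y then (1 : ℝ) else 0) / Fintype.card (Messages K) with hp'
    have hP : (∑ w, if linkOutput (fun i => x i (localPart (merge (notAbove J) w₀ w) i)) J = some y
        then (1 : ℝ) else 0) / Fintype.card (Messages K) = p * p' := by
      have e (w : Messages K) : (if linkOutput (fun i =>
          x i (localPart (merge (notAbove J) w₀ w) i)) J = some y then (1 : ℝ) else 0) =
          (if a i w = y then (1 : ℝ) else 0) * if a j w = y then (1 : ℝ) else 0 := by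
        simp only [hout, ite_and, ite_mul, one_mul, zero_mul]
      simp only [e]
      rw [hp, hp', div_mul_div_comm, hind, mul_div_mul_left _ _ hW.ne']
    have hp0 : 0 ≤ p := div_nonneg (Finset.sum_nonneg fun w _ => by split_ifs <;> simp) hW.le
    have hp'0 : 0 ≤ p' := div_nonneg (Finset.sum_nonneg fun w _ => by split_ifs <;> simp) hW.le
    have hp1 : p ≤ 1 := by
      rw [hp, div_le_one hW]
      calc _ ≤ ∑ w : Messages K, (1 : ℝ) := Finset.sum_le_sum fun w _ => by split_ifs <;> simp
        _ = _ := by simp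
    have hps : p ≤ √p := Real.le_sqrt_of_sq_le (by nlinarith)
    refine le_trans (le_of_eq ?_) (mul_le_mul_of_nonneg_right hps hp'0)
    convert hP

/-- Each two transmitters share a pair message, so the letters need not be independent. No message
in `S` is seen by all three, however, and Finner's inequality gives agreement probability at most
`√(p 0 y * p 1 y * p 2 y)`; AM-GM brings this to the form required. -/
theorem linkCost_triple (k : Fin 7 → ℕ) : LinkCost k (notAbove 6) 6 3 := by
  intro K hK x w₀
  have : Nonempty (Messages K) := ⟨fun I => ⟨0, hK I⟩⟩
  have hW : (0 : ℝ) < Fintype.card (Messages K) := by exact_mod_cast Fintype.card_pos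
  let a (i : Fin 3) (w : Messages K) : Fin (k 6) :=
    x i (localPart (merge (notAbove 6) w₀ w) i) 6
  have hout (w : Messages K) (y : Fin (k 6)) :
      linkOutput (fun i => x i (localPart (merge (notAbove 6) w₀ w) i)) 6 = some y ↔
        a 0 w = y ∧ a 1 w = y ∧ a 2 w = y := by
    rw [linkOutput_eq_some_iff]
    simp [users, a]
  let p (i : Fin 3) (y : Fin (k 6)) : ℝ :=
    (∑ w, if a i w = y then (1 : ℝ) else 0) / Fintype.card (Messages K)
  have hp0 (i y) : 0 ≤ p i y :=
    div_nonneg (Finset.sum_nonneg fun w _ => by split_ifs <;> simp) hW.le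
  have hp1 (i) : ∑ y, p i y = 1 := by
    simp only [p]
    rw [← Finset.sum_div, Finset.sum_comm, div_eq_one_iff_eq hW.ne']
    simp
  refine exists_reference_of_agreement _ (a 0) (fun w y h => ((hout w y).1 h).1)
    (fun y => (p 1 y + p 2 y) / 2) (fun y => ?_) ?_ fun y => ?_
  · linarith [hp0 1 y, hp0 2 y]
  · rw [← Finset.sum_div, Finset.sum_add_distrib, hp1, hp1]
    norm_num
  · have hdep (i : Fin 3) := dependsOn_localPart (notAbove 6) w₀ i fun l =>
      if x i l 6 = y then (1 : ℝ) else 0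
    have h0 : ∀ I, I ∈ notAbove 6 ∧ 0 ∈ users I → I ∉ ({1, 2, 5} : Finset (Fin 7)) := by decide
    have h1 : ∀ I, I ∈ notAbove 6 ∧ 1 ∈ users I →
        I ∈ ({1, 2, 5} : Finset (Fin 7)) ∨ I ∈ ({3} : Finset (Fin 7)) := by decide
    have h2 : ∀ I, I ∈ notAbove 6 ∧ 2 ∈ users I →
        I ∈ ({1, 2, 5} : Finset (Fin 7)) ∨ I ∉ ({3} : Finset (Fin 7)) := by decide
    -- `T` holds the messages unknown to transmitter `0`; `A` is the message shared by transmitters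
    -- `0` and `1`.
    have hfin := sq_sum_mul_mul_le (K := K) (T := {1, 2, 5}) (A := {3})
      (f := fun w => if a 0 w = y then (1 : ℝ) else 0)
      (g := fun w => if a 1 w = y then (1 : ℝ) else 0)
      (h := fun w => if a 2 w = y then (1 : ℝ) else 0)
      (DependsOn.mono (fun I hI => h0 I hI) (hdep 0))
      (DependsOn.mono (fun I hI => h1 I hI) (hdep 1))
      (DependsOn.mono (fun I hI => h2 I hI) (hdep 2))
      (fun w => by split_ifs <;> simp) (fun w => by split_ifs <;> simp)
      (fun w => by split_ifs <;> simp)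
    have e (w : Messages K) : (if linkOutput (fun i =>
        x i (localPart (merge (notAbove 6) w₀ w) i)) 6 = some y then (1 : ℝ) else 0) =
        (if a 0 w = y then (1 : ℝ) else 0) *
          ((if a 1 w = y then (1 : ℝ) else 0) * if a 2 w = y then (1 : ℝ) else 0) := by
      simp only [hout, ite_and, ite_mul, one_mul, zero_mul]
    have hsq : ((∑ w, if linkOutput (fun i => x i (localPart (merge (notAbove 6) w₀ w) i)) 6 =
        some y then (1 : ℝ) else 0) / Fintype.card (Messages K)) ^ 2 ≤
        p 0 y * (p 1 y * p 2 y) := by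
      simp only [e, p]
      rw [div_pow, div_mul_div_comm, div_mul_div_comm, div_le_div_iff₀ (by positivity)
        (by positivity)]
      refine le_trans (le_of_eq ?_) ((mul_le_mul_of_nonneg_right hfin
        (sq_nonneg (Fintype.card (Messages K) : ℝ))).trans (le_of_eq rfl))
      ring
    have hle : √(p 0 y * (p 1 y * p 2 y)) ≤ √(p 0 y) * ((p 1 y + p 2 y) / 2) := by
      rw [Real.sqrt_mul (hp0 0 y)]
      refine mul_le_mul_of_nonneg_left (Real.sqrt_le_iff.2 ⟨?_, ?_⟩) (Real.sqrt_nonneg _)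
      · linarith [hp0 1 y, hp0 2 y]
      · nlinarith [sq_nonneg (p 1 y - p 2 y)]
    refine le_trans ?_ hle
    refine Real.le_sqrt_of_sq_le ?_
    convert hsq

/-! ### Cut-set bounds and the multicast region -/

theorem LinkCost.mono {k : Fin 7 → ℕ} {S : Finset (Fin 7)} {J : Fin 7} {κ κ' : ℝ}
    (h : LinkCost k S J κ) (hle : κ ≤ κ') : LinkCost k S J κ' := by
  intro K hK x w₀
  obtain ⟨q, h0, h1, h2, h3⟩ := h K hK x w₀
  exact ⟨q, h0, h1, h2, h3.trans (mul_le_mul_of_nonneg_left hle (Nat.cast_nonneg _))⟩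

theorem log_two_pow (m : ℕ) : Real.log ((2 ^ m : ℕ) : ℝ) = m * Real.log 2 := by
  push_cast
  rw [Real.log_pow]

/-- The cut-set bound obtained from link channels that just support the rates `R'`: the active
links `act` are the private ones in `P`, and links that are useless for the messages in `S`. -/
theorem sum_le_of_mem_multicastRegion {Rstar R R' : Fin 7 → ℝ} (hRstar : 0 ≤ Rstar)
    (hR : R ∈ multicastRegion Rstar) (hR' : 0 ≤ R') (hcone : Rstar - R' ∈ multicastCone)
    (S P act : Finset (Fin 7)) (hact : ∀ J, J ∉ act → R' J = 0)
    (hP : ∀ J ∈ P, users J = {firstUser J})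
    (hS : ∀ J ∉ P, J ∈ act → ∀ k, LinkCost k S J 3) :
    ∑ I ∈ S, R I ≤ ∑ J ∈ P, R' J := by
  have hlog2 : 0 < Real.log 2 := Real.log_pos one_lt_two
  -- The loss is at most one bit per link of `P` from rounding up the alphabets, plus leakage of at
  -- most 3 nats on each of seven links, all weighted by `δ`.
  have key (δ : ℝ) (h0 : 0 < δ) (h1 : δ ≤ 1) : (∑ I ∈ S, R I) * Real.log 2 ≤
      (∑ J ∈ P, R' J) * Real.log 2 + (P.card * Real.log 2 + 21) * δ := by
    -- The `+ 1` makes `δ * m J` exceed `R' J` strictly, as achievability needs. Inactive links get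
    -- a one-letter alphabet and cost nothing.
    let m (J : Fin 7) : ℕ := if J ∈ act then ⌊R' J / δ⌋₊ + 1 else 0
    let k (J : Fin 7) : ℕ := 2 ^ m J
    have hk (J : Fin 7) : 0 < k J := pow_pos two_pos _
    have hach : Achievable (linkChannel k δ h0.le h1) R' := by
      refine achievable_linkChannel h0 h1 hk hR' fun J => ?_
      by_cases hJ : J ∈ act
      · right
        rw [log_two_pow, ← mul_assoc]
        refine mul_lt_mul_of_pos_right ?_ hlog2
        simp only [m, if_pos hJ]
        have := Nat.lt_floor_add_one (R' J / δ)
        rw [div_lt_iff₀ h0] at this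
        push_cast
        linarith
      · exact Or.inl (hact J hJ)
    have hmem := capacityRegion_of_mem_cone (subset_closure hach) hRstar hcone
    have hRmem : R ∈ capacityRegion (linkChannel k δ h0.le h1) :=
      Set.mem_iInter₂.1 hR _ hmem
    have hbound := capacityRegion_converse (S := S)
      (κ := fun J => if J ∈ P then Real.log (k J) else 3)
      (fun J => by
        split_ifs
        · exact Real.log_natCast_nonneg _
        · norm_num)
      (fun J => by
        split_ifs with hJ
        · exact linkCost_log hk S (Or.inl (hP J hJ))
        · by_cases hJa : J ∈ act
          · exact hS J hJ hJa k
          · have hk1 : k J = 1 := by simp [k, m, hJa]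
            exact (linkCost_log hk S (Or.inr hk1)).mono (by rw [hk1]; simp)) hRmem
    refine hbound.trans ?_
    have h1 : ∑ J, (if J ∈ P then Real.log (k J) else 3) ≤
        ∑ J ∈ P, (R' J / δ + 1) * Real.log 2 + 21 := by
      rw [← Finset.sum_filter_add_sum_filter_not Finset.univ (· ∈ P), Finset.filter_univ_mem]
      refine add_le_add (Finset.sum_le_sum fun J hJ => ?_) ?_
      · rw [if_pos hJ, log_two_pow]
        refine mul_le_mul_of_nonneg_right ?_ hlog2.le
        have hpos : 0 ≤ R' J / δ := div_nonneg (hR' J) h0.le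
        simp only [m]
        split_ifs
        · push_cast
          linarith [Nat.floor_le hpos]
        · push_cast
          linarith
      · calc _ ≤ ∑ J ∈ Finset.univ.filter (fun J => ¬ J ∈ P), (3 : ℝ) := by
              refine Finset.sum_le_sum fun J hJ => ?_
              rw [if_neg (Finset.mem_filter.1 hJ).2]
          _ ≤ ∑ J : Fin 7, (3 : ℝ) :=
              Finset.sum_le_sum_of_subset_of_nonneg (Finset.filter_subset _ _) fun _ _ _ => by
                norm_num
          _ = 21 := by norm_num
    calc _ ≤ δ * (∑ J ∈ P, (R' J / δ + 1) * Real.log 2 + 21) :=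
          mul_le_mul_of_nonneg_left h1 h0.le
      _ = _ := by
          rw [← Finset.sum_mul, Finset.sum_add_distrib, ← Finset.sum_div, Finset.sum_const,
            nsmul_eq_mul]
          field_simp
          ring
  by_contra! hlt
  have hgap := mul_lt_mul_of_pos_right hlt hlog2
  obtain ⟨c, hc0, hc⟩ := exists_pos_mul_lt (sub_pos.2 hgap) (P.card * Real.log 2 + 21)
  have h1 := key (min 1 c) (lt_min one_pos hc0) (min_le_left _ _)
  have h2 : (P.card * Real.log 2 + 21) * min 1 c ≤ (P.card * Real.log 2 + 21) * c :=
    mul_le_mul_of_nonneg_left (min_le_right _ _) (by positivity)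
  linarith

theorem linkCost_three_of_disjoint {S : Finset (Fin 7)} {J : Fin 7}
    (h : ∀ I ∈ S, Disjoint (users I) (users J)) (k : Fin 7 → ℕ) : LinkCost k S J 3 :=
  (linkCost_zero k S h).mono (by norm_num)

theorem multicastRegion_nonneg {Rstar R : Fin 7 → ℝ} (hRstar : 0 ≤ Rstar)
    (hR : R ∈ multicastRegion Rstar) : 0 ≤ R := by
  -- One channel supporting `Rstar` is needed, since an empty intersection would be the whole space.
  let k (J : Fin 7) : ℕ := 2 ^ (⌊Rstar J⌋₊ + 1)
  have hach : Achievable (linkChannel k 1 zero_le_one le_rfl) Rstar := by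
    refine achievable_linkChannel one_pos le_rfl (fun J => pow_pos two_pos _) hRstar fun J => ?_
    right
    rw [log_two_pow, one_mul]
    refine mul_lt_mul_of_pos_right ?_ (Real.log_pos one_lt_two)
    push_cast
    exact Nat.lt_floor_add_one _
  exact capacityRegion_nonneg (Set.mem_iInter₂.1 hR _ (subset_closure hach))

theorem multicastRegion_eq {Rstar : Fin 7 → ℝ} (hRstar : 0 ≤ Rstar) :
    multicastRegion Rstar = {R | 0 ≤ R ∧ R - Rstar ∈ multicastCone} := by
  ext R
  constructor
  swap
  · rintro ⟨h0, hc⟩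
    exact Set.mem_iInter₂.2 fun ch hch => capacityRegion_of_mem_cone hch h0 hc
  intro hR
  refine ⟨multicastRegion_nonneg hRstar hR, ?_⟩
  have p0 := hRstar 0; have p1 := hRstar 1; have p2 := hRstar 2; have p3 := hRstar 3
  have p4 := hRstar 4; have p5 := hRstar 5; have p6 := hRstar 6
  simp only [Pi.zero_apply] at p0 p1 p2 p3 p4 p5 p6
  set r := Rstar with hr
  have main (v : Fin 7 → ℝ) (S P act : Finset (Fin 7)) (hv : 0 ≤ v)
      (hcone : r - v ∈ multicastCone) (hact : ∀ J, J ∉ act → v J = 0)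
      (hP : ∀ J ∈ P, users J = {firstUser J})
      (hS : ∀ J ∉ P, J ∈ act → ∀ k, LinkCost k S J 3) :=
    sum_le_of_mem_multicastRegion hRstar hR hv hcone S P act hact hP hS
  -- In `c1` to `c6` only private links are used. Messages of `S` travel on links of transmitters in
  -- the cut, all others on the remaining private links, whose transmitters know nothing of `S`.
  have c1 := main ![r 0, r 1 + r 3 + r 5 + r 6, r 2 + r 4, 0, 0, 0, 0]
    {0} {0} {0, 1, 2}
    (by intro J; fin_cases J <;> simp <;> linarith)
    (by
      rw [mem_multicastCone_iff, mulVec_le_zero_iff]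
      refine ⟨?_, ?_, ?_, ?_, ?_, ?_, ?_, ?_, ?_, ?_, ?_⟩ <;> simp <;> linarith)
    (by intro J; fin_cases J <;> simp) (by decide)
    (fun J h1 h2 => linkCost_three_of_disjoint (by revert J; decide))
  have c2 := main ![r 0 + r 3 + r 4 + r 6, r 1, r 2 + r 5, 0, 0, 0, 0]
    {1} {1} {0, 1, 2}
    (by intro J; fin_cases J <;> simp <;> linarith)
    (by
      rw [mem_multicastCone_iff, mulVec_le_zero_iff]
      refine ⟨?_, ?_, ?_, ?_, ?_, ?_, ?_, ?_, ?_, ?_, ?_⟩ <;> simp <;> linarith)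
    (by intro J; fin_cases J <;> simp) (by decide)
    (fun J h1 h2 => linkCost_three_of_disjoint (by revert J; decide))
  have c3 := main ![r 0 + r 3 + r 4 + r 6, r 1 + r 5, r 2, 0, 0, 0, 0]
    {2} {2} {0, 1, 2}
    (by intro J; fin_cases J <;> simp <;> linarith)
    (by
      rw [mem_multicastCone_iff, mulVec_le_zero_iff]
      refine ⟨?_, ?_, ?_, ?_, ?_, ?_, ?_, ?_, ?_, ?_, ?_⟩ <;> simp <;> linarith)
    (by intro J; fin_cases J <;> simp) (by decide)
    (fun J h1 h2 => linkCost_three_of_disjoint (by revert J; decide))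
  have c4 := main ![r 0 + r 3, r 1, r 2 + r 4 + r 5 + r 6, 0, 0, 0, 0]
    {0, 1, 3} {0, 1} {0, 1, 2}
    (by intro J; fin_cases J <;> simp <;> linarith)
    (by
      rw [mem_multicastCone_iff, mulVec_le_zero_iff]
      refine ⟨?_, ?_, ?_, ?_, ?_, ?_, ?_, ?_, ?_, ?_, ?_⟩ <;> simp <;> linarith)
    (by intro J; fin_cases J <;> simp) (by decide)
    (fun J h1 h2 => linkCost_three_of_disjoint (by revert J; decide))
  have c5 := main ![r 0 + r 4, r 1 + r 3 + r 5 + r 6, r 2, 0, 0, 0, 0]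
    {0, 2, 4} {0, 2} {0, 1, 2}
    (by intro J; fin_cases J <;> simp <;> linarith)
    (by
      rw [mem_multicastCone_iff, mulVec_le_zero_iff]
      refine ⟨?_, ?_, ?_, ?_, ?_, ?_, ?_, ?_, ?_, ?_, ?_⟩ <;> simp <;> linarith)
    (by intro J; fin_cases J <;> simp) (by decide)
    (fun J h1 h2 => linkCost_three_of_disjoint (by revert J; decide))
  have c6 := main ![r 0 + r 3 + r 4 + r 6, r 1 + r 5, r 2, 0, 0, 0, 0]
    {1, 2, 5} {1, 2} {0, 1, 2}
    (by intro J; fin_cases J <;> simp <;> linarith)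
    (by
      rw [mem_multicastCone_iff, mulVec_le_zero_iff]
      refine ⟨?_, ?_, ?_, ?_, ?_, ?_, ?_, ?_, ?_, ?_, ?_⟩ <;> simp <;> linarith)
    (by intro J; fin_cases J <;> simp) (by decide)
    (fun J h1 h2 => linkCost_three_of_disjoint (by revert J; decide))
  -- In `c7` to `c10` the cut contains all singletons, so no private link is free. The messages
  -- outside `S` use a shared link `J` with `S = notAbove J`, which is nearly useless for `S`.
  have c7 := main ![r 0 + r 4, r 1 + r 5, r 2, r 3 + r 6, 0, 0, 0]
    {0, 1, 2, 4, 5} {0, 1, 2} {0, 1, 2, 3}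
    (by intro J; fin_cases J <;> simp <;> linarith)
    (by
      rw [mem_multicastCone_iff, mulVec_le_zero_iff]
      refine ⟨?_, ?_, ?_, ?_, ?_, ?_, ?_, ?_, ?_, ?_, ?_⟩ <;> simp <;> linarith)
    (by intro J; fin_cases J <;> simp) (by decide)
    (fun J h1 h2 k => by
      obtain rfl : J = 3 := by revert J; decide
      exact (by decide : notAbove 3 = {0, 1, 2, 4, 5}) ▸ linkCost_pair k rfl)
  have c8 := main ![r 0 + r 3, r 1 + r 5, r 2, 0, r 4 + r 6, 0, 0]
    {0, 1, 2, 3, 5} {0, 1, 2} {0, 1, 2, 4}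
    (by intro J; fin_cases J <;> simp <;> linarith)
    (by
      rw [mem_multicastCone_iff, mulVec_le_zero_iff]
      refine ⟨?_, ?_, ?_, ?_, ?_, ?_, ?_, ?_, ?_, ?_, ?_⟩ <;> simp <;> linarith)
    (by intro J; fin_cases J <;> simp) (by decide)
    (fun J h1 h2 k => by
      obtain rfl : J = 4 := by revert J; decide
      exact (by decide : notAbove 4 = {0, 1, 2, 3, 5}) ▸ linkCost_pair k rfl)
  have c9 := main ![r 0 + r 3 + r 4, r 1, r 2, 0, 0, r 5 + r 6, 0]
    {0, 1, 2, 3, 4} {0, 1, 2} {0, 1, 2, 5}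
    (by intro J; fin_cases J <;> simp <;> linarith)
    (by
      rw [mem_multicastCone_iff, mulVec_le_zero_iff]
      refine ⟨?_, ?_, ?_, ?_, ?_, ?_, ?_, ?_, ?_, ?_, ?_⟩ <;> simp <;> linarith)
    (by intro J; fin_cases J <;> simp) (by decide)
    (fun J h1 h2 k => by
      obtain rfl : J = 5 := by revert J; decide
      exact (by decide : notAbove 5 = {0, 1, 2, 3, 4}) ▸ linkCost_pair k rfl)
  have c10 := main ![r 0 + r 3 + r 4, r 1 + r 5, r 2, 0, 0, 0, r 6]
    {0, 1, 2, 3, 4, 5} {0, 1, 2} {0, 1, 2, 6}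
    (by intro J; fin_cases J <;> simp <;> linarith)
    (by
      rw [mem_multicastCone_iff, mulVec_le_zero_iff]
      refine ⟨?_, ?_, ?_, ?_, ?_, ?_, ?_, ?_, ?_, ?_, ?_⟩ <;> simp <;> linarith)
    (by intro J; fin_cases J <;> simp) (by decide)
    (fun J h1 h2 k => by
      obtain rfl : J = 6 := by revert J; decide
      exact (by decide : notAbove 6 = {0, 1, 2, 3, 4, 5}) ▸ linkCost_triple k)
  have c11 := main ![r 0 + r 3 + r 4 + r 6, r 1 + r 5, r 2, 0, 0, 0, 0]
    {0, 1, 2, 3, 4, 5, 6} {0, 1, 2} {0, 1, 2}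
    (by intro J; fin_cases J <;> simp <;> linarith)
    (by
      rw [mem_multicastCone_iff, mulVec_le_zero_iff]
      refine ⟨?_, ?_, ?_, ?_, ?_, ?_, ?_, ?_, ?_, ?_, ?_⟩ <;> simp <;> linarith)
    (by intro J; fin_cases J <;> simp) (by decide)
    (fun J h1 h2 => absurd h2 h1)
  rw [mem_multicastCone_iff, mulVec_le_zero_iff]
  simp [Finset.sum_insert, Finset.sum_singleton] at c1 c2 c3 c4 c5 c6 c7 c8 c9 c10 c11 ⊢
  refine ⟨?_, ?_, ?_, ?_, ?_, ?_, ?_, ?_, ?_, ?_, ?_⟩ <;> linarith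

/-- The inequality for the set of all indices bounds the total rate, and thereby each nonnegative
coordinate. -/
theorem isPolytope_multicastRegion {Rstar : Fin 7 → ℝ} (hRstar : 0 ≤ Rstar) :
    IsPolytope (multicastRegion Rstar) := by
  rw [multicastRegion_eq hRstar]
  constructor
  · refine (Metric.isBounded_Icc (0 : Fin 7 → ℝ) (fun _ => ∑ I, Rstar I)).subset ?_
    rintro R ⟨h0, hc⟩
    rw [mem_multicastCone_iff, mulVec_le_zero_iff] at hc
    obtain ⟨-, -, -, -, -, -, -, -, -, -, h⟩ := hc
    refine ⟨h0, fun I => (Finset.single_le_sum (fun I _ => h0 I) (Finset.mem_univ I)).trans ?_⟩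
    simp only [Pi.sub_apply] at h
    simp only [Fin.sum_univ_seven]
    linarith
  · refine ⟨11 + 7, Matrix.of fun i => Fin.append (fun k I => GMACᵀ k I)
      (fun k I => (-(1 : Matrix (Fin 7) (Fin 7) ℝ)) k I) i, Fin.append (GMACᵀ *ᵥ Rstar) 0, ?_⟩
    set A : Matrix (Fin (11 + 7)) (Fin 7) ℝ := Matrix.of fun i => Fin.append (fun k I => GMACᵀ k I)
      (fun k I => (-(1 : Matrix (Fin 7) (Fin 7) ℝ)) k I) i with hA
    ext R
    have e1 (k : Fin 11) : (A *ᵥ R) (Fin.castAdd 7 k) = (GMACᵀ *ᵥ R) k := by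
      simp [hA, Matrix.mulVec, dotProduct]
    have e2 (k : Fin 7) : (A *ᵥ R) (Fin.natAdd 11 k) = -R k := by
      have : (A *ᵥ R) (Fin.natAdd 11 k) = ((-(1 : Matrix (Fin 7) (Fin 7) ℝ)) *ᵥ R) k := by
        simp [hA, Matrix.mulVec, dotProduct]
      rw [this, Matrix.neg_mulVec, Matrix.one_mulVec, Pi.neg_apply]
    have e3 : R - Rstar ∈ multicastCone ↔ GMACᵀ *ᵥ R ≤ GMACᵀ *ᵥ Rstar := by
      rw [mem_multicastCone_iff, Matrix.mulVec_sub, sub_nonpos]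
    constructor
    · rintro ⟨h0, hc⟩ i
      refine Fin.addCases (fun k => ?_) (fun k => ?_) i
      · rw [e1, Fin.append_left]
        exact e3.1 hc k
      · rw [e2, Fin.append_right]
        exact neg_nonpos.2 (h0 k)
    · intro h
      refine ⟨fun k => ?_, e3.2 fun k => ?_⟩
      · have := h (Fin.natAdd 11 k)
        rw [e2, Fin.append_right] at this
        exact neg_nonpos.1 this
      · have := h (Fin.castAdd 7 k)
        rwa [e1, Fin.append_left] at this

end MulticastMAC

end

theorem theorem4p2 :
    (∀ Rstar : Fin 7 → ℝ, 0 ≤ Rstar →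
      MulticastMAC.multicastRegion Rstar =
          {R : Fin 7 → ℝ | 0 ≤ R ∧ MulticastMAC.GMACᵀ *ᵥ (R - Rstar) ≤ 0} ∧
        MulticastMAC.multicastRegion Rstar =
          {R : Fin 7 → ℝ | 0 ≤ R ∧ R - Rstar ∈ MulticastMAC.multicastCone} ∧
        MulticastMAC.IsPolytope (MulticastMAC.multicastRegion Rstar)) ∧
    MulticastMAC.extremalRays MulticastMAC.multicastCone =
      Set.range (fun j : Fin 10 => MulticastMAC.ray (fun I => MulticastMAC.HMAC I j)) ∧
    (MulticastMAC.extremalRays MulticastMAC.multicastCone).ncard = 10 ∧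
    {d : Fin 7 → ℝ | MulticastMAC.IsDistinct d} =
      Set.range (fun j : Fin 10 => MulticastMAC.normalize (fun I => MulticastMAC.HMAC I j)) ∧
    {d : Fin 7 → ℝ | MulticastMAC.IsDistinct d}.ncard = 10 := by
  have hray : (fun j : Fin 10 => MulticastMAC.ray (fun I => MulticastMAC.HMAC I j)) =
      fun j => MulticastMAC.ray (MulticastMAC.hcol j) :=
    funext fun j => by rw [MulticastMAC.hcol_eq]
  have hnorm : (fun j : Fin 10 => MulticastMAC.normalize (fun I => MulticastMAC.HMAC I j)) =
      fun j => MulticastMAC.normalize (MulticastMAC.hcol j) :=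
    funext fun j => by rw [MulticastMAC.hcol_eq]
  rw [hray, hnorm]
  refine ⟨fun Rstar h => ⟨MulticastMAC.multicastRegion_eq h, MulticastMAC.multicastRegion_eq h,
    MulticastMAC.isPolytope_multicastRegion h⟩, MulticastMAC.extremalRays_multicastCone, ?_,
    MulticastMAC.setOf_isDistinct, ?_⟩
  · rw [MulticastMAC.extremalRays_multicastCone,
      Set.ncard_range_of_injective MulticastMAC.ray_hcol_injective, Nat.card_fin]
  · rw [MulticastMAC.setOf_isDistinct,
      Set.ncard_range_of_injective MulticastMAC.normalize_hcol_injective, Nat.card_fin]
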